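/- **Setting.** Let $d\ge 1$, $\kappa,m>0$, and let $0\le a\in L^1(\mathbb R^d)$ with $\int_{\mathbb R^d}a(x)\,dx=1$; write $(a*u)(x)=\int_{\mathbb R^d}a(x-y)u(y)\,dy$. Let $E$ be one of the Banach spaces $C_{ub}(\mathbb R^d)$ (bounded uniformly continuous functions), $C_b(\mathbb R^d)$ (bounded continuous functions), both with the supremum norm, or $L^\infty(\mathbb R^d)$; in the last case (in)equalities are understood a.e. and locally uniform convergence means essentially uniform convergence on every compact set. Let $G:E\to E$, $\theta>0$, $E_\theta^+=\{v\in E:0\le v\le\theta\}$ and $(T_yv)(x)=v(x-y)$. Consider $$\frac{\partial u}{\partial t}=\kappa\,(a*u)-m\,u-u\,Gu,\qquad t>0. \tag{1}$$ **Assumptions.** * (A1) $\beta:=\kappa-m>0$. * (A2) $0=G0\le Gv\le G\theta=\beta$ for all $v\in E_\theta^+$. * (A3) There is $l_\theta>0$ with $\|Gv-Gw\|_E\le l_\theta\|v-w\|_E$ for all $v,w\in E_\theta^+$. * (A4) There is $p\ge 0$ such that $\kappa\, a*v-v\,Gv+pv\le\kappa\, a*w-w\,Gw+pw$ for all $v,w\in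 E_\theta^+$ with $v\le w$. * (A5) There is $\varrho>0$ such that $a(x)\ge\varrho$ for a.a. $x$ with $|x|<\varrho$. * (A6) If $v_n,v\in E_\theta^+$ and $v_n\to v$ locally uniformly, then $Gv_n\to Gv$ locally uniformly. * (A7) $T_yGv=GT_yv$ for all $v\in E_\theta^+$, $y\in\mathbb R^d$. * (A8) $Gr<\beta$ for every constant $r\in(0,\theta)$. * (A9) $\int_{\mathbb R^d}|y|\,a(y)\,dy<\infty$. Put $\mathfrak m:=\kappa\int_{\mathbb R^d}x\,a(x)\,dx\in\mathbb R^d$. **The spreading set.** For $f\in E_\theta^+$ and $t>0$ let $Q_tf=u(\cdot,t)$, where $u\in C([0,\infty)\to E)\cap C^1((0,\infty)\to E)$ is the classical solution of (1) with $u(\cdot,0)=f$ and values in $E_\theta^+$. Let $N_\theta$ be the set of continuous non-increasing $\varphi:\mathbb R\to\mathbb R$ with $\varphi(s)=0$ for $s\ge0$ and $\varphi(-\infty)\in(0,\theta)$. Fix $\varphi\in N_\theta$. For $t>0$, $c\in\mathbb R$ and $\xi\in\mathbb R^d$ with $|\xi|=1$ set $(V_{s,c,\xi}g)(x)=g(x\cdot\xi+s+c)$,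 $f_0=\varphi$ and $$f_{n+1}(s)=\max\bigl\{\varphi(s),\,(Q_t(V_{s,c,\xi}f_n))(0)\bigr\},\qquad s\in\mathbb R,\ n\ge0,$$ where for $E=L^\infty(\mathbb R^d)$ the value at $0$ is that of the continuous representative. Set $f_{t,c,\xi}(s)=\lim_{n\to\infty}f_n(s)$, $f_{t,c,\xi}(\infty)=\lim_{s\to\infty}f_{t,c,\xi}(s)$, $$c_t^*(\xi)=\sup\{c\in\mathbb R: f_{t,c,\xi}(\infty)=\theta\}\in[-\infty,\infty],\qquad \Upsilon_t=\{x\in\mathbb R^d: x\cdot\xi\le c_t^*(\xi)\ \text{ for all } \xi \text{ with } |\xi|=1\}.$$ **Proposition.** Let (A1)–(A9) hold. Then, for every $\varphi\in N_\theta$, $$t\,\mathfrak m\in\operatorname{int}(\Upsilon_t)\qquad\text{for every } t>0 .$$ In particular, there is a compact set $K\subset\operatorname{int}(\Upsilon_1)$ with $\mathfrak m\in\operatorname{int}(K)$, and $\frac1j\mathfrak m\in\operatorname{int}(\Upsilon_{1/j})$ for every $j\in\mathbb N$, $j\ge1$. -/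

import Mathlib

open MeasureTheory Set Filter Topology
open scoped ENNReal

namespace HairTrigger

/-- The Euclidean space `ℝ^d`. -/
abbrev X (d : ℕ) : Type := EuclideanSpace ℝ (Fin d)

/-- The Banach space `L^∞(ℝ^d)` with the essential supremum norm (Lebesgue measure). -/
abbrev Linf (d : ℕ) : Type := Lp ℝ ∞ (volume : Measure (X d))

/-- `C_b(ℝ^d)`, realized inside `L^∞(ℝ^d)` as the classes of the bounded continuous functions.
As Lebesgue measure charges every nonempty open set, a class contains at most one continuous
function, the `L^∞`-norm of the class is the supremum norm of that function, and pointwise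
inequalities between continuous functions are the same as almost everywhere inequalities. -/
noncomputable def cbSubmodule (d : ℕ) : Submodule ℝ (Linf d) where
  carrier := {v | ∃ g : X d → ℝ, Continuous g ∧ (∃ C : ℝ, ∀ x, |g x| ≤ C) ∧
    (v : X d → ℝ) =ᵐ[volume] g}
  zero_mem' := ⟨fun _ => 0, continuous_const, ⟨0, by simp⟩, Lp.coeFn_zero ℝ ∞ volume⟩
  add_mem' := by
    rintro v w ⟨g, hg, ⟨C, hC⟩, hvg⟩ ⟨h, hh, ⟨D, hD⟩, hwh⟩
    refine ⟨fun x => g x + h x, hg.add hh, ⟨C + D, fun x => ?_⟩, ?_⟩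
    · exact (abs_add_le _ _).trans (add_le_add (hC x) (hD x))
    · filter_upwards [Lp.coeFn_add v w, hvg, hwh] with x h1 h2 h3
      rw [h1, Pi.add_apply, h2, h3]
  smul_mem' := by
    rintro c v ⟨g, hg, ⟨C, hC⟩, hvg⟩
    refine ⟨fun x => c * g x, continuous_const.mul hg, ⟨|c| * C, fun x => ?_⟩, ?_⟩
    · rw [abs_mul]
      exact mul_le_mul_of_nonneg_left (hC x) (abs_nonneg c)
    · filter_upwards [Lp.coeFn_smul c v, hvg] with x h1 h2
      rw [h1, Pi.smul_apply, h2, smul_eq_mul]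

/-- The space of bounded uniformly continuous functions on `ℝ^d`, realized inside `L^∞(ℝ^d)`
in the same way. -/
noncomputable def bucSubmodule (d : ℕ) : Submodule ℝ (Linf d) where
  carrier := {v | ∃ g : X d → ℝ, UniformContinuous g ∧ (∃ C : ℝ, ∀ x, |g x| ≤ C) ∧
    (v : X d → ℝ) =ᵐ[volume] g}
  zero_mem' := ⟨fun _ => 0, uniformContinuous_const, ⟨0, by simp⟩, Lp.coeFn_zero ℝ ∞ volume⟩
  add_mem' := by
    rintro v w ⟨g, hg, ⟨C, hC⟩, hvg⟩ ⟨h, hh, ⟨D, hD⟩, hwh⟩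
    refine ⟨fun x => g x + h x, hg.add hh, ⟨C + D, fun x => ?_⟩, ?_⟩
    · exact (abs_add_le _ _).trans (add_le_add (hC x) (hD x))
    · filter_upwards [Lp.coeFn_add v w, hvg, hwh] with x h1 h2 h3
      rw [h1, Pi.add_apply, h2, h3]
  smul_mem' := by
    rintro c v ⟨g, hg, ⟨C, hC⟩, hvg⟩
    refine ⟨fun x => c * g x, ?_, ⟨|c| * C, fun x => ?_⟩, ?_⟩
    · exact hg.const_smul c
    · rw [abs_mul]
      exact mul_le_mul_of_nonneg_left (hC x) (abs_nonneg c)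
    · filter_upwards [Lp.coeFn_smul c v, hvg] with x h1 h2
      rw [h1, Pi.smul_apply, h2, smul_eq_mul]

/-- The three function spaces in which the equation is considered. -/
inductive SpaceKind : Type
  | buc
  | cb
  | linf

/-- The three spaces as closed subspaces of `L^∞(ℝ^d)`. -/
noncomputable def phaseSpace (d : ℕ) : SpaceKind → Submodule ℝ (Linf d)
  | SpaceKind.buc => bucSubmodule d
  | SpaceKind.cb => cbSubmodule d
  | SpaceKind.linf => ⊤

/-- The Banach space `E` (with the norm of `L^∞`): one of `C_ub(ℝ^d)`, `C_b(ℝ^d)`,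
`L^∞(ℝ^d)`. -/
abbrev E (k : SpaceKind) (d : ℕ) : Type := phaseSpace d k

variable {k : SpaceKind} {d : ℕ}

/-- A representative of an element of `E`; it is used only up to null sets. -/
noncomputable def ev (v : E k d) : X d → ℝ := ((v : Linf d) : X d → ℝ)

/-- The constant function `r` as an element of `E`. -/
noncomputable def constE (k : SpaceKind) (d : ℕ) (r : ℝ) : E k d :=
  ⟨(memLp_top_const r).toLp (fun _ : X d => r), by
    have h := (memLp_top_const (μ := (volume : Measure (X d))) r).coeFn_toLp
    cases k with
    | buc => exact ⟨fun _ => r, uniformContinuous_const, ⟨|r|, fun _ => le_rfl⟩, h⟩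
    | cb => exact ⟨fun _ => r, continuous_const, ⟨|r|, fun _ => le_rfl⟩, h⟩
    | linf => exact Submodule.mem_top⟩

/-- The translation operator `(T_y v)(x) = v(x - y)` on `E`. -/
noncomputable def translate (y : X d) (v : E k d) : E k d :=
  ⟨Lp.compMeasurePreserving (fun x => x - y) (measurePreserving_sub_right volume y) v.1, by
    have h := Lp.coeFn_compMeasurePreserving v.1
      (measurePreserving_sub_right (volume : Measure (X d)) y)
    have hq := (measurePreserving_sub_right
      (volume : Measure (X d)) y).quasiMeasurePreserving
    obtain ⟨v, hv⟩ := v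
    cases k with
    | buc =>
      obtain ⟨g, hg, ⟨C, hC⟩, hvg⟩ := hv
      exact ⟨fun x => g (x - y), hg.comp (uniformContinuous_id.sub uniformContinuous_const),
        ⟨C, fun x => hC _⟩, h.trans (hq.ae_eq_comp hvg)⟩
    | cb =>
      obtain ⟨g, hg, ⟨C, hC⟩, hvg⟩ := hv
      exact ⟨fun x => g (x - y), hg.comp (continuous_id.sub continuous_const),
        ⟨C, fun x => hC _⟩, h.trans (hq.ae_eq_comp hvg)⟩
    | linf => exact Submodule.mem_top⟩

theorem ev_const (r : ℝ) : ev (constE k d r) =ᵐ[volume] fun _ => r :=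
  (memLp_top_const (μ := (volume : Measure (X d))) r).coeFn_toLp

theorem ev_translate (y : X d) (v : E k d) :
    ev (translate y v) =ᵐ[volume] fun x => ev v (x - y) :=
  Lp.coeFn_compMeasurePreserving v.1 (measurePreserving_sub_right (volume : Measure (X d)) y)

/-- The order `v ≤ w` of `E`. -/
def LEae (v w : E k d) : Prop := ∀ᵐ x, ev v x ≤ ev w x

/-- The order interval `E_r^+ = {v ∈ E : 0 ≤ v ≤ r}`. -/
def tube (k : SpaceKind) (d : ℕ) (r : ℝ) : Set (E k d) :=
  {v | ∀ᵐ x, 0 ≤ ev v x ∧ ev v x ≤ r}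

/-- Locally uniform convergence: (essentially) uniform convergence on every compact set. -/
def LocUnif (v : ℕ → E k d) (w : E k d) : Prop :=
  ∀ K : Set (X d), IsCompact K → ∀ ε : ℝ, 0 < ε →
    ∀ᶠ n in atTop, ∀ᵐ x, x ∈ K → |ev (v n) x - ev w x| ≤ ε

/-- The convolution `(a * v)(x) = ∫ a(x - y) v(y) dy`. -/
noncomputable def conv (a v : X d → ℝ) (x : X d) : ℝ := ∫ y, a (x - y) * v y

/-- `u` is a classical solution on `[0, ∞)` of
`∂u/∂t = κ (a * u) - m u - u (G u)`, `u(0) = f`: it is continuous as an `E`-valued function on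
`[0, ∞)`, continuously differentiable on `(0, ∞)`, and satisfies the equation in `E`
for all `t > 0`. -/
def IsClassicalSolution (κ m : ℝ) (a : X d → ℝ) (G : E k d → E k d) (f : E k d)
    (u : ℝ → E k d) : Prop :=
  u 0 = f ∧ ContinuousOn u (Ici 0) ∧
    ∃ u' : ℝ → E k d, ContinuousOn u' (Ioi 0) ∧ ∀ t : ℝ, 0 < t →
      HasDerivAt u (u' t) t ∧
      ev (u' t) =ᵐ[volume] fun x =>
        κ * conv a (ev (u t)) x - m * ev (u t) x - ev (u t) x * ev (G (u t)) x

open Classical in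
/-- The solution map `Q_t f = u(·, t)` for `f ∈ E_θ^+`, where `u` is the classical solution
starting from `f` with values in `E_θ^+` (the value is `0` if there is no such solution). -/
noncomputable def solMap (κ m θ : ℝ) (a : X d → ℝ) (G : E k d → E k d) (t : ℝ)
    (f : E k d) : E k d :=
  if h : ∃ u : ℝ → E k d, IsClassicalSolution κ m a G f u ∧ ∀ s, 0 ≤ s → u s ∈ tube k d θ
  then h.choose t else 0

open Classical in
/-- A function on `ℝ^d` as an element of `E` (with value `0` if it does not represent one). -/
noncomputable def toE (k : SpaceKind) (h : X d → ℝ) : E k d :=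
  if hv : ∃ v : E k d, ev v =ᵐ[volume] h then hv.choose else 0

open Classical in
/-- The value of `v ∈ E` at a point: the value of its continuous representative, which is unique
(`0` if there is none). -/
noncomputable def valueAt (v : E k d) (x : X d) : ℝ :=
  if h : ∃ g : X d → ℝ, Continuous g ∧ ev v =ᵐ[volume] g then h.choose x else 0

/-- The set `N_θ` of the continuous non-increasing `φ : ℝ → ℝ` with `φ = 0` on `[0, ∞)` and
`φ(-∞) ∈ (0, θ)`. -/
def profiles (θ : ℝ) : Set (ℝ → ℝ) :=
  {φ | Continuous φ ∧ Antitone φ ∧ (∀ s, 0 ≤ s → φ s = 0) ∧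
    ∃ l ∈ Ioo 0 θ, Tendsto φ atBot (𝓝 l)}

/-- `(V_{s,c,ξ} g)(x) = g(x · ξ + s + c)`, as an element of `E`. -/
noncomputable def planeWave (k : SpaceKind) (s c : ℝ) (ξ : X d) (g : ℝ → ℝ) : E k d :=
  toE k fun x => g (inner ℝ x ξ + s + c)

/-- `(R_{c,ξ} g)(s) = max {φ(s), (Q (V_{s,c,ξ} g))(0)}`. -/
noncomputable def waveOp (Q : E k d → E k d) (φ : ℝ → ℝ) (c : ℝ) (ξ : X d) (g : ℝ → ℝ) :
    ℝ → ℝ :=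
  fun s => max (φ s) (valueAt (Q (planeWave k s c ξ g)) 0)

/-- The iterates `f_0 = φ`, `f_{n+1} = R_{c,ξ} f_n`. -/
noncomputable def waveIter (Q : E k d → E k d) (φ : ℝ → ℝ) (c : ℝ) (ξ : X d) : ℕ → ℝ → ℝ
  | 0 => φ
  | n + 1 => waveOp Q φ c ξ (waveIter Q φ c ξ n)

/-- The pointwise limit `f_{c,ξ} = lim f_n`. -/
noncomputable def waveLim (Q : E k d → E k d) (φ : ℝ → ℝ) (c : ℝ) (ξ : X d) (s : ℝ) : ℝ :=
  limUnder atTop fun n => waveIter Q φ c ξ n s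

/-- The spreading speed `c^*(ξ) = sup {c : f_{c,ξ}(∞) = θ}`, an element of `[-∞, ∞]`. -/
noncomputable def spreadingSpeed (Q : E k d → E k d) (φ : ℝ → ℝ) (θ : ℝ) (ξ : X d) : EReal :=
  sSup ((fun c : ℝ => (c : EReal)) '' {c | Tendsto (waveLim Q φ c ξ) atTop (𝓝 θ)})

/-- The spreading set `{x : x · ξ ≤ c^*(ξ) for all unit vectors ξ}`. -/
def spreadingSet (Q : E k d → E k d) (φ : ℝ → ℝ) (θ : ℝ) : Set (X d) :=
  {x | ∀ ξ : X d, ‖ξ‖ = 1 → ((inner ℝ x ξ : ℝ) : EReal) ≤ spreadingSpeed Q φ θ ξ}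

/-- The vector `κ ∫ x a(x) dx`. -/
noncomputable def firstMoment (κ : ℝ) (a : X d → ℝ) : X d := κ • ∫ x, a x • x

end HairTrigger

open HairTrigger

/-!
The argument rests on three properties of the solution map `Q_t`: it preserves the order, it is
continuous for the locally uniform convergence, and it strictly increases the constants in
`(0, θ)`. All of them are read off from the explicit Euler scheme. With
`F v = κ (a * v) - m v - v G v`, the step `v ↦ v + τ F v` maps the order interval `[0, θ]` into
itself and preserves the order as soon as `τ (m + p) ≤ 1`; iterated `n` times with `τ = t / n` it
converges to `Q_t` in norm at the rate `C / n`, uniformly in the initial value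
(`Reaction.norm_solMap_sub_iterate_le`). Hence every property that survives iteration and uniform
limits passes from one Euler step to `Q_t`. Existence of solutions follows from the Picard–Lindelöf
theorem for the field `F` precomposed with the truncation of a function to `[0, θ]`, and the Euler
scheme shows that the truncation is never active.

With `𝔪 = firstMoment κ a`, the spreading speed in the direction `ξ` exceeds the drift `t 𝔪 · ξ` for
the following reason. Near `u = 0` the equation is `∂u/∂t = κ (a * u) - (m + small) u`, with positive growth rate
`γ = (κ - m) / 2` if `u` is small. The function `min(R, (c t - x · ξ)⁺)`, multiplied by a small
constant, is a subsolution for some speed `c > 𝔪 · ξ` (`exists_travelling_ramp`): on its linear part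
the convolution reproduces the drift exactly, at a distance from the front the growth pays for the
excess speed, and at the front the convexity of the positive part does, because `a` is bounded below
near the origin. The excess speed `δ` is uniform in `ξ`. In the frame moving with the speed
`𝔪 · ξ + δ / 2` this ramp advances in each step of the wave iteration (`Reaction.ramp_le_waveIter`),
so the limit of the iteration has a positive lower bound. If its infimum `r` were below `θ`, then
comparison with `Q_t` of a constant slightly below `r`, cut off far ahead, would give a better lower
bound (`Reaction.exists_gt_le_waveLim`). So the limit is identically `θ`, and the ball of radius
`t δ / 2` around `t 𝔪` lies in the spreading set.

In `L^∞` the values `(Q_t V g)(0)` make sense because `Q_t` commutes with translations and is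
Lipschitz: translations act continuously on `Q_t V g`, which forces a uniformly continuous
representative (`exists_uniformContinuous_rep`). The same fact shows that `G` maps constants to
constants.
-/

namespace HairTrigger

/-! ### Autonomous equations with a Lipschitz field and the Euler scheme -/

/-- One step `v ↦ v + τ F(v)` of the explicit Euler scheme for `u' = F(u)`. -/
def eulerStep {B : Type*} [AddCommGroup B] [Module ℝ B] (F : B → B) (τ : ℝ) (v : B) : B :=
  v + τ • F v

section Euler
variable {B : Type*} [NormedAddCommGroup B] [NormedSpace ℝ B]

theorem iterate_mem_of_mapsTo {α : Type*} {S : α → α} {C : Set α} (hS : ∀ v ∈ C, S v ∈ C)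
    {v : α} (hv : v ∈ C) (n : ℕ) : S^[n] v ∈ C := by
  induction n with
  | zero => exact hv
  | succ n ih => rw [Function.iterate_succ_apply']; exact hS _ ih

theorem norm_eulerStep_sub_le {F : B → B} {C : Set B} {L τ : ℝ} (hτ : 0 ≤ τ)
    (hL : ∀ v ∈ C, ∀ w ∈ C, ‖F v - F w‖ ≤ L * ‖v - w‖) {v w : B} (hv : v ∈ C) (hw : w ∈ C) :
    ‖eulerStep F τ v - eulerStep F τ w‖ ≤ (1 + τ * L) * ‖v - w‖ := by
  have h : eulerStep F τ v - eulerStep F τ w = (v - w) + τ • (F v - F w) := by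
    simp only [eulerStep, smul_sub]; abel
  rw [h]
  refine (norm_add_le _ _).trans ?_
  rw [norm_smul, Real.norm_of_nonneg hτ]
  nlinarith [mul_le_mul_of_nonneg_left (hL v hv w hw) hτ]

theorem norm_euler_local_error {F : B → B} {C : Set B} {L M : ℝ} (hL0 : 0 ≤ L)
    (hL : ∀ v ∈ C, ∀ w ∈ C, ‖F v - F w‖ ≤ L * ‖v - w‖) (hM : ∀ v ∈ C, ‖F v‖ ≤ M)
    {u : ℝ → B} (huC : ∀ s, 0 ≤ s → u s ∈ C)
    (hu : ContinuousOn u (Ici 0)) (hu' : ∀ s, 0 ≤ s → HasDerivWithinAt u (F (u s)) (Ici s) s)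
    {s τ : ℝ} (hs : 0 ≤ s) (hτ : 0 ≤ τ) :
    ‖u (s + τ) - eulerStep F τ (u s)‖ ≤ L * M * τ ^ 2 := by
  have hM0 : 0 ≤ M := (norm_nonneg _).trans (hM _ (huC s hs))
  have hsub : Icc s (s + τ) ⊆ Ici 0 := fun r hr => hs.trans hr.1
  have h1 : ∀ r ∈ Icc s (s + τ), ‖u r - u s‖ ≤ M * (r - s) :=
    norm_image_sub_le_of_norm_deriv_right_le_segment (hu.mono hsub)
      (fun r hr => hu' r (hs.trans hr.1)) (fun r hr => hM _ (huC r (hs.trans hr.1)))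
  have h2 := norm_image_sub_le_of_norm_deriv_right_le_segment
    (f := fun r => u r - (r - s) • F (u s)) (f' := fun r => F (u r) - (1 : ℝ) • F (u s))
    (a := s) (b := s + τ) (C := L * (M * τ))
    ((hu.mono hsub).sub (by fun_prop))
    (fun r hr => by
      have := hu' r (hs.trans hr.1)
      refine this.sub ?_
      exact ((hasDerivAt_id r).sub_const s).hasDerivWithinAt.smul_const (F (u s)))
    (fun r hr => by
      rw [one_smul]
      refine (hL _ (huC r (hs.trans hr.1)) _ (huC s hs)).trans ?_
      refine mul_le_mul_of_nonneg_left ((h1 r ⟨hr.1, hr.2.le⟩).trans ?_) hL0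
      exact mul_le_mul_of_nonneg_left (by linarith [hr.2]) hM0)
    (s + τ) ⟨by linarith, le_rfl⟩
  have h3 : u (s + τ) - eulerStep F τ (u s) =
      u (s + τ) - (s + τ - s) • F (u s) - (u s - (s - s) • F (u s)) := by
    rw [eulerStep, add_sub_cancel_left, sub_self, zero_smul]; abel
  rw [h3]
  exact h2.trans (le_of_eq (by ring))

/-- Convergence of the Euler scheme of step `t / n`, with the constant depending on the field
only and not on the solution. -/
theorem norm_sub_euler_iterate_le {F : B → B} {C : Set B} {L M : ℝ} (hL0 : 0 ≤ L)
    (hL : ∀ v ∈ C, ∀ w ∈ C, ‖F v - F w‖ ≤ L * ‖v - w‖) (hM : ∀ v ∈ C, ‖F v‖ ≤ M)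
    {u : ℝ → B} (huC : ∀ s, 0 ≤ s → u s ∈ C)
    (hu : ContinuousOn u (Ici 0)) (hu' : ∀ s, 0 ≤ s → HasDerivWithinAt u (F (u s)) (Ici s) s)
    {t : ℝ} (ht : 0 ≤ t) {n : ℕ} (hn : 0 < n)
    (hS : ∀ v ∈ C, eulerStep F (t / n) v ∈ C) :
    ‖u t - (eulerStep F (t / n))^[n] (u 0)‖ ≤ L * M * t ^ 2 * Real.exp (L * t) / n := by
  have hM0 : 0 ≤ M := (norm_nonneg _).trans (hM _ (huC 0 le_rfl))
  have hn' : (0 : ℝ) < n := Nat.cast_pos.2 hn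
  set τ := t / n with hτd
  have hτ : 0 ≤ τ := div_nonneg ht hn'.le
  have hq : 1 ≤ 1 + τ * L := by nlinarith [mul_nonneg hτ hL0]
  have key : ∀ j : ℕ, ‖u (j * τ) - (eulerStep F τ)^[j] (u 0)‖ ≤
      j * (L * M * τ ^ 2) * (1 + τ * L) ^ j := by
    intro j
    induction j with
    | zero => simp
    | succ j ih =>
      rw [Function.iterate_succ_apply']
      have hj : 0 ≤ (j : ℝ) * τ := by positivity
      have e1 := norm_euler_local_error hL0 hL hM huC hu hu' hj hτ
      have e2 := norm_eulerStep_sub_le hτ hL (huC _ hj)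
        (iterate_mem_of_mapsTo hS (huC 0 le_rfl) j)
      have e3 : ((j + 1 : ℕ) : ℝ) * τ = j * τ + τ := by push_cast; ring
      rw [e3]
      refine (norm_sub_le_norm_sub_add_norm_sub _ (eulerStep F τ (u (j * τ))) _).trans ?_
      have e4 := mul_le_mul_of_nonneg_left ih (by linarith : 0 ≤ 1 + τ * L)
      have e5 : L * M * τ ^ 2 ≤ L * M * τ ^ 2 * (1 + τ * L) ^ (j + 1) :=
        le_mul_of_one_le_right (by positivity) (one_le_pow₀ hq)
      calc _ ≤ L * M * τ ^ 2 * (1 + τ * L) ^ (j + 1) +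
            (1 + τ * L) * (j * (L * M * τ ^ 2) * (1 + τ * L) ^ j) := by linarith
        _ = _ := by push_cast; ring
  have h := key n
  have e : (n : ℝ) * τ = t := by rw [hτd]; field_simp
  rw [e] at h
  refine h.trans ?_
  have hexp : (1 + τ * L) ^ n ≤ Real.exp (L * t) := by
    have h1 : 1 + τ * L ≤ Real.exp (τ * L) := by linarith [Real.add_one_le_exp (τ * L)]
    refine (pow_le_pow_left₀ (by linarith) h1 n).trans (le_of_eq ?_)
    rw [← Real.exp_nat_mul]; congr 1; rw [← e]; ring
  have e6 : (n : ℝ) * (L * M * τ ^ 2) = L * M * t ^ 2 / n := by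
    rw [hτd]; field_simp
  rw [e6]
  calc _ ≤ L * M * t ^ 2 / n * Real.exp (L * t) :=
        mul_le_mul_of_nonneg_left hexp (by positivity)
    _ = _ := by ring

/-- A bounded globally Lipschitz field has global solutions. -/
theorem exists_global_solution [CompleteSpace B] {F : B → B} {L : NNReal} (hL : LipschitzWith L F)
    {M : ℝ} (hM : ∀ v, ‖F v‖ ≤ M) (f : B) :
    ∃ u : ℝ → B, u 0 = f ∧ ∀ t, HasDerivAt u (F (u t)) t := by
  have hM0 : 0 ≤ M := (norm_nonneg _).trans (hM f)
  have loc : ∀ n : ℕ, ∃ u : ℝ → B, u 0 = f ∧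
      ∀ t ∈ Ioo (-(n + 1 : ℝ)) (n + 1), HasDerivAt u (F (u t)) t := by
    intro n
    have hn : (0 : ℝ) ≤ n + 1 := by positivity
    have hPL : IsPicardLindelof (fun _ => F) (tmin := -(n + 1 : ℝ)) (tmax := n + 1)
        ⟨0, by constructor <;> linarith⟩ f (M.toNNReal * (n + 1)) 0 M.toNNReal L := by
      refine ⟨fun _ _ => hL.lipschitzOnWith, fun _ _ => continuousOn_const, fun _ _ x _ => ?_, ?_⟩
      · rw [Real.coe_toNNReal _ hM0]; exact hM x
      · simp
    obtain ⟨u, h0, hu⟩ := hPL.exists_eq_forall_mem_Icc_hasDerivWithinAt₀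
    exact ⟨u, h0, fun t ht => (hu t (Ioo_subset_Icc_self ht)).hasDerivAt (Icc_mem_nhds ht.1 ht.2)⟩
  choose u h0 hu using loc
  have agree : ∀ n m : ℕ, n ≤ m → EqOn (u n) (u m) (Ioo (-(n + 1 : ℝ)) (n + 1)) := by
    intro n m hnm
    have hnm' : (n : ℝ) ≤ m := Nat.cast_le.2 hnm
    have hn : (0 : ℝ) ≤ n := by positivity
    refine ODE_solution_unique_of_mem_Ioo (v := fun _ => F) (s := fun _ => univ) (K := L)
      (t₀ := 0) (fun _ _ => hL.lipschitzOnWith) ⟨by linarith, by linarith⟩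
      (fun t ht => ⟨hu n t ht, mem_univ _⟩)
      (fun t ht => ⟨hu m t ⟨by linarith [ht.1], by linarith [ht.2]⟩, mem_univ _⟩) ?_
    rw [h0, h0]
  have hglue : ∀ n : ℕ, ∀ t ∈ Ioo (-(n + 1 : ℝ)) (n + 1), u ⌈|t|⌉₊ t = u n t := by
    intro n t ht
    have hc := Nat.le_ceil |t|
    rcases le_total ⌈|t|⌉₊ n with h | h
    · exact agree _ _ h ⟨by linarith [neg_abs_le t], by linarith [le_abs_self t]⟩
    · exact (agree _ _ h ht).symm
  refine ⟨fun t => u ⌈|t|⌉₊ t, by simp [h0], fun t => ?_⟩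
  have ht : t ∈ Ioo (-((⌈|t|⌉₊ : ℕ) + 1 : ℝ)) ((⌈|t|⌉₊ : ℕ) + 1) := by
    have hc := Nat.le_ceil |t|
    exact ⟨by linarith [neg_abs_le t], by linarith [le_abs_self t]⟩
  refine (hu ⌈|t|⌉₊ t ht).congr_of_eventuallyEq ?_
  filter_upwards [Ioo_mem_nhds ht.1 ht.2] with r hr using hglue _ r hr

/-- A closed set that is invariant under the Euler steps of small size is positively invariant
under the flow. -/
theorem solution_mem_of_eulerStep_mem {F : B → B} {L M : ℝ} (hL0 : 0 ≤ L)
    (hL : ∀ v w, ‖F v - F w‖ ≤ L * ‖v - w‖) (hM : ∀ v, ‖F v‖ ≤ M) {C : Set B} (hC : IsClosed C)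
    {τ₀ : ℝ} (hτ₀ : 0 < τ₀) (hS : ∀ τ, 0 ≤ τ → τ ≤ τ₀ → ∀ v ∈ C, eulerStep F τ v ∈ C)
    {u : ℝ → B} (hu' : ∀ s, HasDerivAt u (F (u s)) s) (h0 : u 0 ∈ C) {t : ℝ} (ht : 0 ≤ t) :
    u t ∈ C := by
  obtain ⟨n₀, hn₀⟩ := exists_nat_gt (t / τ₀)
  have hn0 : 0 < n₀ := by
    have : (0 : ℝ) < n₀ := (div_nonneg ht hτ₀.le).trans_lt hn₀
    exact_mod_cast this
  have hsmall : ∀ n : ℕ, n₀ ≤ n → t / n ≤ τ₀ := by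
    intro n hn
    have h1 : (0 : ℝ) < n := by exact_mod_cast hn0.trans_le hn
    have h2 : (n₀ : ℝ) ≤ n := Nat.cast_le.2 hn
    rw [div_le_iff₀ h1]
    rw [div_lt_iff₀ hτ₀] at hn₀
    nlinarith
  have hlim : Tendsto (fun n : ℕ => (eulerStep F (t / n))^[n] (u 0)) atTop (𝓝 (u t)) := by
    rw [tendsto_iff_norm_sub_tendsto_zero]
    refine squeeze_zero' (Eventually.of_forall fun _ => norm_nonneg _) ?_
      (tendsto_const_div_atTop_nhds_zero_nat (L * M * t ^ 2 * Real.exp (L * t)))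
    filter_upwards [eventually_gt_atTop 0] with n hn
    rw [norm_sub_rev]
    exact norm_sub_euler_iterate_le (C := univ) hL0 (fun v _ w _ => hL v w) (fun v _ => hM v)
      (fun _ _ => mem_univ _) (fun s _ => (hu' s).continuousAt.continuousWithinAt)
      (fun s _ => (hu' s).hasDerivWithinAt) ht hn (fun _ _ => mem_univ _)
  refine hC.mem_of_tendsto hlim ?_
  filter_upwards [eventually_ge_atTop n₀] with n hn
  exact iterate_mem_of_mapsTo (hS _ (by positivity) (hsmall n hn)) h0 n

/-- A solution for `t > 0` that is continuous at `t = 0` solves the equation at `t = 0` in the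
sense of right derivatives. -/
theorem hasDerivWithinAt_Ici_of_solution {F : B → B} {u : ℝ → B} (hu : ContinuousOn u (Ici 0))
    (hF : ContinuousOn (fun s => F (u s)) (Ici 0)) (hu' : ∀ s, 0 < s → HasDerivAt u (F (u s)) s)
    {s : ℝ} (hs : 0 ≤ s) : HasDerivWithinAt u (F (u s)) (Ici s) s := by
  rcases hs.eq_or_lt with rfl | hs
  · refine hasDerivWithinAt_Ici_of_tendsto_deriv (s := Ioi 0)
      (fun r hr => (hu' r hr).differentiableAt.differentiableWithinAt)
      ((hu 0 self_mem_Ici).mono Ioi_subset_Ici_self) self_mem_nhdsWithin ?_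
    refine (((hF 0 self_mem_Ici).mono Ioi_subset_Ici_self).tendsto).congr' ?_
    filter_upwards [self_mem_nhdsWithin] with r hr using (hu' r hr).deriv.symm
  · exact (hu' s hs).hasDerivWithinAt

end Euler

variable {k : SpaceKind} {d : ℕ}

/-! ### The phase spaces -/

theorem E_ext {v w : E k d} (h : ev v =ᵐ[volume] ev w) : v = w :=
  Subtype.ext (Lp.ext h)

theorem aestronglyMeasurable_ev (v : E k d) : AEStronglyMeasurable (ev v) volume :=
  Lp.aestronglyMeasurable v.1

theorem ev_add (v w : E k d) : ev (v + w) =ᵐ[volume] fun x => ev v x + ev w x :=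
  Lp.coeFn_add v.1 w.1

theorem ev_sub (v w : E k d) : ev (v - w) =ᵐ[volume] fun x => ev v x - ev w x :=
  Lp.coeFn_sub v.1 w.1

theorem ev_smul (c : ℝ) (v : E k d) : ev (c • v) =ᵐ[volume] fun x => c * ev v x :=
  Lp.coeFn_smul c v.1

theorem ae_abs_le_norm (v : E k d) : ∀ᵐ x, |ev v x| ≤ ‖v‖ := by
  have h : ∀ᵐ x, ‖ev v x‖ₑ ≤ eLpNormEssSup (ev v) volume := ae_le_eLpNormEssSup
  filter_upwards [h] with x hx
  have hfin : eLpNormEssSup (ev v) volume ≠ ∞ := by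
    have := Lp.eLpNorm_ne_top v.1
    rwa [eLpNorm_exponent_top] at this
  have h2 : ‖v‖ = (eLpNormEssSup (ev v) volume).toReal := by
    rw [← eLpNorm_exponent_top]; exact Lp.norm_def v.1
  rw [h2, ← Real.norm_eq_abs, ← toReal_enorm]
  exact ENNReal.toReal_mono hfin hx

theorem norm_le_of_ae {v : E k d} {C : ℝ} (hC : 0 ≤ C) (h : ∀ᵐ x, |ev v x| ≤ C) : ‖v‖ ≤ C := by
  have h2 : ‖v‖ = (eLpNormEssSup (ev v) volume).toReal := by
    rw [← eLpNorm_exponent_top]; exact Lp.norm_def v.1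
  rw [h2]
  exact ENNReal.toReal_le_of_le_ofReal hC (eLpNormEssSup_le_of_ae_bound h)

theorem norm_sub_le_of_ae {v w : E k d} {C : ℝ} (hC : 0 ≤ C)
    (h : ∀ᵐ x, |ev v x - ev w x| ≤ C) : ‖v - w‖ ≤ C :=
  norm_le_of_ae hC (by filter_upwards [h, ev_sub v w] with x hx h1; rwa [h1])

theorem ae_abs_sub_le_norm (v w : E k d) : ∀ᵐ x, |ev v x - ev w x| ≤ ‖v - w‖ := by
  filter_upwards [ae_abs_le_norm (v - w), ev_sub v w] with x hx h1
  rwa [← h1]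

theorem ev_toE {h : X d → ℝ} (hv : ∃ v : E k d, ev v =ᵐ[volume] h) :
    ev (toE k h) =ᵐ[volume] h := by
  rw [toE, dif_pos hv]; exact hv.choose_spec

/-- Every bounded uniformly continuous function represents an element of each of the spaces. -/
theorem exists_ev_eq_of_uniformContinuous (k : SpaceKind) {g : X d → ℝ} (hg : UniformContinuous g)
    {C : ℝ} (hC : ∀ x, |g x| ≤ C) : ∃ v : E k d, ev v =ᵐ[volume] g := by
  have hm : MemLp g ∞ volume :=
    memLp_top_of_bound hg.continuous.aestronglyMeasurable C (Eventually.of_forall hC)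
  cases k with
  | buc => exact ⟨⟨hm.toLp g, g, hg, ⟨C, hC⟩, hm.coeFn_toLp⟩, hm.coeFn_toLp⟩
  | cb => exact ⟨⟨hm.toLp g, g, hg.continuous, ⟨C, hC⟩, hm.coeFn_toLp⟩, hm.coeFn_toLp⟩
  | linf => exact ⟨⟨hm.toLp g, Submodule.mem_top⟩, hm.coeFn_toLp⟩

/-- The spaces are closed under products. -/
theorem exists_ev_eq_mul (v w : E k d) : ∃ z : E k d, ev z =ᵐ[volume] fun x => ev v x * ev w x := by
  have hm : MemLp (fun x => ev v x * ev w x) ∞ volume := by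
    refine memLp_top_of_bound ((aestronglyMeasurable_ev v).mul (aestronglyMeasurable_ev w))
      (‖v‖ * ‖w‖) ?_
    filter_upwards [ae_abs_le_norm v, ae_abs_le_norm w] with x h1 h2
    rw [Real.norm_eq_abs, abs_mul]
    exact mul_le_mul h1 h2 (abs_nonneg _) (norm_nonneg _)
  obtain ⟨v, hv⟩ := v
  obtain ⟨w, hw⟩ := w
  have bd : ∀ {g h : X d → ℝ} {C D : ℝ}, (∀ x, |g x| ≤ C) → (∀ x, |h x| ≤ D) →
      ∀ x, |g x * h x| ≤ C * D := fun hC hD x => by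
    rw [abs_mul]
    exact mul_le_mul (hC x) (hD x) (abs_nonneg _) ((abs_nonneg _).trans (hC x))
  cases k with
  | buc =>
    obtain ⟨g, hg, ⟨C, hC⟩, hvg⟩ := hv
    obtain ⟨h, hh, ⟨D, hD⟩, hwh⟩ := hw
    refine ⟨⟨hm.toLp _, fun x => g x * h x, ?_, ⟨C * D, bd hC hD⟩,
      hm.coeFn_toLp.trans (hvg.mul hwh)⟩, hm.coeFn_toLp⟩
    rw [Metric.uniformContinuous_iff] at hg hh ⊢
    intro ε hε
    have hC0 : 0 ≤ C := (abs_nonneg _).trans (hC 0)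
    have hD0 : 0 ≤ D := (abs_nonneg _).trans (hD 0)
    obtain ⟨δ₁, hδ₁, h1⟩ := hg (ε / (2 * (D + 1))) (by positivity)
    obtain ⟨δ₂, hδ₂, h2⟩ := hh (ε / (2 * (C + 1))) (by positivity)
    refine ⟨min δ₁ δ₂, lt_min hδ₁ hδ₂, fun {x y} hxy => ?_⟩
    have h1' := h1 (hxy.trans_le (min_le_left _ _))
    have h2' := h2 (hxy.trans_le (min_le_right _ _))
    rw [Real.dist_eq] at h1' h2' ⊢
    rw [lt_div_iff₀ (by positivity)] at h1' h2'
    have e : g x * h x - g y * h y = (g x - g y) * h x + g y * (h x - h y) := by ring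
    rw [e]
    have e1 : |(g x - g y) * h x| ≤ |g x - g y| * D := by
      rw [abs_mul]; exact mul_le_mul_of_nonneg_left (hD x) (abs_nonneg _)
    have e2 : |g y * (h x - h y)| ≤ |h x - h y| * C := by
      rw [abs_mul, mul_comm]; exact mul_le_mul_of_nonneg_left (hC y) (abs_nonneg _)
    have e3 := abs_add_le ((g x - g y) * h x) (g y * (h x - h y))
    nlinarith [abs_nonneg (g x - g y), abs_nonneg (h x - h y)]
  | cb =>
    obtain ⟨g, hg, ⟨C, hC⟩, hvg⟩ := hv
    obtain ⟨h, hh, ⟨D, hD⟩, hwh⟩ := hw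
    exact ⟨⟨hm.toLp _, fun x => g x * h x, hg.mul hh, ⟨C * D, bd hC hD⟩,
      hm.coeFn_toLp.trans (hvg.mul hwh)⟩, hm.coeFn_toLp⟩
  | linf => exact ⟨⟨hm.toLp _, Submodule.mem_top⟩, hm.coeFn_toLp⟩

/-- The spaces are closed under truncation at the levels `0` and `θ`. -/
theorem exists_ev_eq_clamp (θ : ℝ) (v : E k d) :
    ∃ z : E k d, ev z =ᵐ[volume] fun x => min (max (ev v x) 0) θ := by
  have hm : MemLp (fun x => min (max (ev v x) 0) θ) ∞ volume := by
    refine memLp_top_of_bound (((aestronglyMeasurable_ev v).sup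
      aestronglyMeasurable_const).inf aestronglyMeasurable_const) (‖v‖ + |θ|) ?_
    filter_upwards [ae_abs_le_norm v] with x h1
    rw [Real.norm_eq_abs]
    rw [abs_le] at h1 ⊢
    have h3 := neg_abs_le θ
    have h4 := abs_nonneg θ
    have h5 := norm_nonneg v
    constructor
    · exact le_min (by linarith [le_max_right (ev v x) 0]) (by linarith)
    · exact (min_le_left _ _).trans (max_le (by linarith) (by linarith))
  have bd : ∀ {g : X d → ℝ} {C : ℝ}, (∀ x, |g x| ≤ C) →
      ∀ x, |min (max (g x) 0) θ| ≤ C + |θ| := fun {g C} hC x => by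
    have h1 := abs_le.1 (hC x)
    have h0 := (abs_nonneg _).trans (hC x)
    have h3 := neg_abs_le θ
    have h4 := abs_nonneg θ
    rw [abs_le]
    constructor
    · exact le_min (by linarith [le_max_right (g x) 0]) (by linarith)
    · exact (min_le_left _ _).trans (max_le (by linarith) (by linarith))
  have comp : ∀ {g h : X d → ℝ}, g =ᵐ[volume] h →
      (fun x => min (max (g x) 0) θ) =ᵐ[volume] fun x => min (max (h x) 0) θ := fun hgh => by
    filter_upwards [hgh] with x hx; rw [hx]
  obtain ⟨v, hv⟩ := v
  cases k with
  | buc =>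
    obtain ⟨g, hg, ⟨C, hC⟩, hvg⟩ := hv
    refine ⟨⟨hm.toLp _, fun x => min (max (g x) 0) θ, ?_, ⟨_, bd hC⟩,
      hm.coeFn_toLp.trans (comp hvg)⟩, hm.coeFn_toLp⟩
    have hcl : UniformContinuous fun s : ℝ => min (max s 0) θ :=
      ((LipschitzWith.id.max_const 0).min_const θ).uniformContinuous
    exact hcl.comp hg
  | cb =>
    obtain ⟨g, hg, ⟨C, hC⟩, hvg⟩ := hv
    exact ⟨⟨hm.toLp _, fun x => min (max (g x) 0) θ, by fun_prop, ⟨_, bd hC⟩,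
      hm.coeFn_toLp.trans (comp hvg)⟩, hm.coeFn_toLp⟩
  | linf => exact ⟨⟨hm.toLp _, Submodule.mem_top⟩, hm.coeFn_toLp⟩

theorem forall_le_of_ae_le {g h : X d → ℝ} (hg : Continuous g) (hh : Continuous h)
    (H : ∀ᵐ x, g x ≤ h x) (x : X d) : g x ≤ h x := by
  have h1 : (fun x => max (g x) (h x)) = h := by
    refine Measure.eq_of_ae_eq (μ := (volume : Measure (X d))) ?_ (hg.max hh) hh
    filter_upwards [H] with y hy using max_eq_right hy
  rw [← h1]; exact le_max_left _ _

/-- An essentially uniform limit of bounded (uniformly) continuous functions is represented by a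
function of the same kind. -/
theorem exists_uniform_limit {v : ℕ → Linf d} {w : Linf d} (hvw : Tendsto v atTop (𝓝 w))
    {g : ℕ → X d → ℝ} (hg : ∀ n, Continuous (g n)) (hgb : ∀ n, ∃ C : ℝ, ∀ x, |g n x| ≤ C)
    (hvg : ∀ n, (v n : X d → ℝ) =ᵐ[volume] g n) :
    ∃ G : X d → ℝ, TendstoUniformly g G atTop ∧ Continuous G ∧ (∃ C : ℝ, ∀ x, |G x| ≤ C) ∧
      (w : X d → ℝ) =ᵐ[volume] G := by
  choose C hC using hgb
  let b : ℕ → BoundedContinuousFunction (X d) ℝ := fun n =>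
    BoundedContinuousFunction.ofNormedAddCommGroup (g n) (hg n) (C n) (hC n)
  have aeb : ∀ z z' : Linf d, ∀ᵐ x, |z x - z' x| ≤ ‖z - z'‖ := fun z z' =>
    ae_abs_sub_le_norm (k := SpaceKind.linf) ⟨z, Submodule.mem_top⟩ ⟨z', Submodule.mem_top⟩
  have hdist : ∀ n m, dist (b n) (b m) ≤ dist (v n) (v m) := by
    intro n m
    rw [BoundedContinuousFunction.dist_le dist_nonneg, dist_eq_norm]
    intro x
    refine forall_le_of_ae_le (g := fun x => dist (b n x) (b m x)) (h := fun _ => ‖v n - v m‖)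
      (by fun_prop) continuous_const ?_ x
    filter_upwards [aeb (v n) (v m), hvg n, hvg m] with y h1 h2 h3
    rw [h2, h3] at h1
    exact h1
  have hcau : CauchySeq b := by
    have := hvw.cauchySeq
    rw [Metric.cauchySeq_iff] at this ⊢
    intro ε hε
    obtain ⟨N, hN⟩ := this ε hε
    exact ⟨N, fun m hm n hn => (hdist m n).trans_lt (hN m hm n hn)⟩
  obtain ⟨G, hG⟩ := cauchySeq_tendsto_of_complete hcau
  refine ⟨G, BoundedContinuousFunction.tendsto_iff_tendstoUniformly.1 hG, G.continuous,
    ⟨‖G‖, G.norm_coe_le_norm⟩, ?_⟩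
  have hae : ∀ᵐ x, ∀ n, |v n x - w x| ≤ ‖v n - w‖ := ae_all_iff.2 fun n => aeb (v n) w
  filter_upwards [hae, ae_all_iff.2 hvg] with x h1 h2
  have t1 : Tendsto (fun n => v n x) atTop (𝓝 (w x)) := by
    rw [tendsto_iff_norm_sub_tendsto_zero]
    exact squeeze_zero (fun _ => norm_nonneg _) h1 (tendsto_iff_norm_sub_tendsto_zero.1 hvw)
  have t2 : Tendsto (fun n => v n x) atTop (𝓝 (G x)) := by
    have := (BoundedContinuousFunction.tendsto_iff_tendstoUniformly.1 hG).tendsto_at x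
    refine this.congr fun n => ?_
    rw [h2 n]; rfl
  exact tendsto_nhds_unique t1 t2

theorem isClosed_phaseSpace (d : ℕ) (k : SpaceKind) :
    IsClosed ((phaseSpace d k : Submodule ℝ (Linf d)) : Set (Linf d)) := by
  cases k with
  | buc =>
    refine IsSeqClosed.isClosed fun v w hv hvw => ?_
    choose g hg hgb hvg using hv
    obtain ⟨G, h1, -, h3, h4⟩ :=
      exists_uniform_limit hvw (fun n => (hg n).continuous) hgb hvg
    exact ⟨G, h1.uniformContinuous (Eventually.of_forall hg).frequently, h3, h4⟩
  | cb =>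
    refine IsSeqClosed.isClosed fun v w hv hvw => ?_
    choose g hg hgb hvg using hv
    obtain ⟨G, -, h2, h3, h4⟩ := exists_uniform_limit hvw hg hgb hvg
    exact ⟨G, h2, h3, h4⟩
  | linf => exact isClosed_univ

instance (k : SpaceKind) (d : ℕ) : CompleteSpace (E k d) :=
  (isClosed_phaseSpace d k).completeSpace_coe

/-! ### Convolution with an integrable kernel -/

theorem integrable_mul_ev {b : X d → ℝ} (hb : Integrable b) (v : E k d) :
    Integrable fun y => b y * ev v y :=
  hb.mul_bdd (aestronglyMeasurable_ev v) (ae_abs_le_norm v)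

theorem integrable_conv {a : X d → ℝ} (ha : Integrable a) (v : E k d) (x : X d) :
    Integrable fun y => a (x - y) * ev v y :=
  integrable_mul_ev (ha.comp_sub_left x) v

theorem conv_congr {a v w : X d → ℝ} (h : v =ᵐ[volume] w) (x : X d) : conv a v x = conv a w x :=
  integral_congr_ae (by filter_upwards [h] with y hy; rw [hy])

theorem conv_eq_swap (a v : X d → ℝ) (x : X d) : conv a v x = ∫ y, a y * v (x - y) := by
  rw [conv, ← integral_sub_left_eq_self (fun y => a y * v (x - y)) volume x]
  simp

theorem conv_translate (a : X d → ℝ) (v : E k d) (y x : X d) :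
    conv a (ev (translate y v)) x = conv a (ev v) (x - y) := by
  rw [conv_congr (ev_translate y v), conv, conv,
    ← integral_sub_right_eq_self (fun z => a (x - y - z) * ev v z) y]
  refine integral_congr_ae (Eventually.of_forall fun z => ?_)
  simp only
  congr 2
  abel

theorem abs_integral_mul_ev_le {b : X d → ℝ} (hb : Integrable b) (v : E k d) :
    |∫ y, b y * ev v y| ≤ (∫ y, |b y|) * ‖v‖ := by
  rw [← integral_mul_const, ← Real.norm_eq_abs]
  refine norm_integral_le_of_norm_le (hb.abs.mul_const _) ?_
  filter_upwards [ae_abs_le_norm v] with y hy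
  rw [Real.norm_eq_abs, abs_mul]
  exact mul_le_mul_of_nonneg_left hy (abs_nonneg _)

theorem abs_conv_sub_le {a : X d → ℝ} (ha : Integrable a) (v w : E k d) (x : X d) :
    |conv a (ev v) x - conv a (ev w) x| ≤ (∫ y, |a y|) * ‖v - w‖ := by
  rw [conv, conv, ← integral_sub (integrable_conv ha v x) (integrable_conv ha w x)]
  have h : ∫ y, (a (x - y) * ev v y - a (x - y) * ev w y) = ∫ y, a (x - y) * ev (v - w) y := by
    refine integral_congr_ae ?_
    filter_upwards [ev_sub v w] with y hy
    rw [hy]; ring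
  rw [h]
  refine (abs_integral_mul_ev_le (ha.comp_sub_left x) (v - w)).trans (le_of_eq ?_)
  rw [integral_sub_left_eq_self (fun y => |a y|) volume x]

theorem conv_const {a : X d → ℝ} (ha1 : ∫ x, a x = 1) (r : ℝ) (x : X d) :
    conv a (ev (constE k d r)) x = r := by
  rw [conv_congr (ev_const r), conv, integral_mul_const,
    integral_sub_left_eq_self a volume x, ha1, one_mul]

/-- Translations act continuously in `L¹`. -/
theorem tendsto_integral_abs_translate_sub {a : X d → ℝ} (ha : Integrable a) :
    Tendsto (fun h : X d => ∫ z, |a (z + h) - a z|) (𝓝 0) (𝓝 0) := by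
  let g : C(X d, C(X d, X d)) := (ContinuousMap.mk (fun p : X d × X d => p.2 + p.1)).curry
  have hm : MemLp a 1 volume := memLp_one_iff_integrable.2 ha
  have hgm : ∀ h, MeasurePreserving (g h) (volume : Measure (X d)) volume := fun h =>
    measurePreserving_add_right volume h
  have hc : Continuous fun h => Lp.compMeasurePreserving (g h) (hgm h) (hm.toLp a) :=
    Continuous.compMeasurePreservingLp (f := fun _ => hm.toLp a) continuous_const g.continuous hgm
      ENNReal.one_ne_top
  have h2 := tendsto_iff_norm_sub_tendsto_zero.1 (hc.tendsto 0)
  refine h2.congr fun h => ?_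
  rw [L1.norm_eq_integral_norm]
  refine integral_congr_ae ?_
  have e1 := Lp.coeFn_compMeasurePreserving (hm.toLp a) (hgm h)
  have e2 := Lp.coeFn_compMeasurePreserving (hm.toLp a) (hgm 0)
  have e3 := (hgm h).quasiMeasurePreserving.ae_eq_comp hm.coeFn_toLp
  have e4 := (hgm 0).quasiMeasurePreserving.ae_eq_comp hm.coeFn_toLp
  filter_upwards [Lp.coeFn_sub (Lp.compMeasurePreserving (g h) (hgm h) (hm.toLp a))
    (Lp.compMeasurePreserving (g 0) (hgm 0) (hm.toLp a)), e1, e2, e3, e4] with z h0 h1 h2 h3 h4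
  rw [h0, Pi.sub_apply, h1, h2, h3, h4, Real.norm_eq_abs]
  simp [g]

theorem uniformContinuous_of_translate {g ω : X d → ℝ} (hω : Tendsto ω (𝓝 0) (𝓝 0))
    (h : ∀ x y, |g (x - y) - g x| ≤ ω y) : UniformContinuous g := by
  rw [Metric.uniformContinuous_iff]
  intro ε hε
  obtain ⟨δ, hδ, H⟩ := Metric.eventually_nhds_iff.1 (hω.eventually (gt_mem_nhds hε))
  refine ⟨δ, hδ, fun {x y} hxy => ?_⟩
  have h1 := h y (y - x)
  rw [sub_sub_cancel] at h1
  rw [Real.dist_eq]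
  refine h1.trans_lt (H ?_)
  rwa [dist_zero_right, ← dist_eq_norm, dist_comm]

theorem uniformContinuous_conv {a : X d → ℝ} (ha : Integrable a) (v : E k d) :
    UniformContinuous (conv a (ev v)) := by
  refine uniformContinuous_of_translate (ω := fun y => (∫ z, |a (z + -y) - a z|) * ‖v‖) ?_ ?_
  · have h := (tendsto_integral_abs_translate_sub ha).comp
      ((continuous_neg (G := X d)).tendsto' 0 0 neg_zero)
    simpa using h.mul_const ‖v‖
  · intro x y
    rw [conv, conv, ← integral_sub (integrable_conv ha v _) (integrable_conv ha v x)]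
    have e : ∀ z, a (x - y - z) * ev v z - a (x - z) * ev v z =
        (a (x - y - z) - a (x - z)) * ev v z := fun z => by ring
    simp_rw [e]
    refine (abs_integral_mul_ev_le
      ((ha.comp_sub_left (x - y)).sub (ha.comp_sub_left x)) v).trans (le_of_eq ?_)
    congr 1
    rw [← integral_sub_left_eq_self (fun z => |a (z + -y) - a z|) volume x]
    refine integral_congr_ae (Eventually.of_forall fun z => ?_)
    simp only [Pi.sub_apply]
    congr 3
    abel

/-! ### Continuous representatives -/

/-- An element of `E` on which translations act continuously has a uniformly continuous
representative: its mollifications are equicontinuous and converge almost everywhere to it. The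
representative is a pointwise limit of the mollifications along an ultrafilter. -/
theorem exists_uniformContinuous_rep {v : E k d} {ω : X d → ℝ} (hω : Tendsto ω (𝓝 0) (𝓝 0))
    (h : ∀ y, ‖translate y v - v‖ ≤ ω y) :
    ∃ g : X d → ℝ, UniformContinuous g ∧ ev v =ᵐ[volume] g ∧ ∀ x y, |g (x - y) - g x| ≤ ω y := by
  let b : ℕ → ContDiffBump (0 : X d) := fun n =>
    ⟨1 / ((n : ℝ) + 1), 2 * (1 / ((n : ℝ) + 1)), by positivity, by
      have : 0 < 1 / ((n : ℝ) + 1) := by positivity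
      linarith⟩
  let a : ℕ → X d → ℝ := fun n => (b n).normed volume
  have ha : ∀ n, Integrable (a n) := fun n => (b n).integrable_normed
  have ha1 : ∀ n, ∫ x, |a n x| = 1 := fun n => by
    rw [← (b n).integral_normed (μ := volume)]
    exact integral_congr_ae (Eventually.of_forall fun x => abs_of_nonneg ((b n).nonneg_normed x))
  have hbd : ∀ x n, conv (a n) (ev v) x ∈ Icc (-‖v‖) ‖v‖ := fun x n => by
    have := abs_integral_mul_ev_le ((ha n).comp_sub_left x) v
    rw [integral_sub_left_eq_self (fun y => |a n y|) volume x, ha1, one_mul] at this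
    exact abs_le.1 this
  have hlim : ∀ x, ∃ l, Tendsto (fun n => conv (a n) (ev v) x) (hyperfilter ℕ) (𝓝 l) := fun x => by
    obtain ⟨l, -, hl⟩ := isCompact_Icc.ultrafilter_le_nhds'
      ((hyperfilter ℕ).map fun n => conv (a n) (ev v) x)
      (mem_map.2 (Eventually.of_forall (hbd x)))
    exact ⟨l, hl⟩
  choose g hg using hlim
  have hmod : ∀ x y, |g (x - y) - g x| ≤ ω y := fun x y => by
    refine le_of_tendsto ((hg (x - y)).sub (hg x)).abs (Eventually.of_forall fun n => ?_)
    rw [← conv_translate]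
    refine (abs_conv_sub_le (ha n) _ _ x).trans ?_
    rw [ha1, one_mul]; exact h y
  refine ⟨g, uniformContinuous_of_translate hω hmod, ?_, hmod⟩
  have hr : Tendsto (fun n => (b n).rOut) atTop (𝓝 0) := by
    have := (tendsto_one_div_add_atTop_nhds_zero_nat (𝕜 := ℝ)).const_mul 2
    rwa [mul_zero] at this
  have hloc : LocallyIntegrable (ev v) volume :=
    (Lp.memLp v.1).locallyIntegrable le_top
  filter_upwards [ContDiffBump.ae_convolution_tendsto_right_of_locallyIntegrable (K := 2) hr
    (Eventually.of_forall fun n => le_rfl) hloc] with x hx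
  refine tendsto_nhds_unique ?_ (hg x)
  have h3 := hx.mono_left Nat.hyperfilter_le_atTop
  refine h3.congr fun n => ?_
  rw [convolution_eq_swap]
  rfl

theorem valueAt_eq {v : E k d} {g : X d → ℝ} (hg : Continuous g) (h : ev v =ᵐ[volume] g)
    (x : X d) : valueAt v x = g x := by
  have hex : ∃ g : X d → ℝ, Continuous g ∧ ev v =ᵐ[volume] g := ⟨g, hg, h⟩
  rw [valueAt, dif_pos hex]
  have := Measure.eq_of_ae_eq (hex.choose_spec.2.symm.trans h) hex.choose_spec.1 hg
  rw [this]

/-- The elements of `E` with a continuous representative: those that have a value at each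
point. -/
def HasContRep (v : E k d) : Prop := ∃ g : X d → ℝ, Continuous g ∧ ev v =ᵐ[volume] g

theorem le_valueAt {v : E k d} (hv : HasContRep v) {U : Set (X d)} (hU : IsOpen U) {x₀ : X d}
    (hx : x₀ ∈ U) {h : X d → ℝ} (hh : Continuous h) (H : ∀ᵐ x, x ∈ U → h x ≤ ev v x) :
    h x₀ ≤ valueAt v x₀ := by
  obtain ⟨g, hg, hvg⟩ := hv
  rw [valueAt_eq hg hvg]
  by_contra! hlt
  have hopen : IsOpen (U ∩ {x | g x < h x}) := hU.inter (isOpen_lt hg hh)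
  have hpos := hopen.measure_pos volume ⟨x₀, hx, hlt⟩
  refine hpos.ne' (measure_mono_null ?_ (ae_iff.1 (H.and hvg)))
  rintro x ⟨hxU, hxl⟩ ⟨h1, h2⟩
  have := h1 hxU
  rw [h2] at this
  exact absurd hxl (not_lt.2 this)

theorem valueAt_mono {v w : E k d} (hv : HasContRep v) (hw : HasContRep w) (h : LEae v w)
    (x : X d) : valueAt v x ≤ valueAt w x := by
  obtain ⟨g, hg, hvg⟩ := hv
  rw [valueAt_eq hg hvg]
  refine le_valueAt hw isOpen_univ (mem_univ x) hg ?_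
  filter_upwards [h, hvg] with y h1 h2 _
  rwa [← h2]

theorem abs_valueAt_sub_le {v w : E k d} (hv : HasContRep v) (hw : HasContRep w) (x : X d) :
    |valueAt v x - valueAt w x| ≤ ‖v - w‖ := by
  obtain ⟨g, hg, hvg⟩ := hv
  obtain ⟨h, hh, hwh⟩ := hw
  rw [valueAt_eq hg hvg, valueAt_eq hh hwh]
  refine forall_le_of_ae_le (g := fun x => |g x - h x|) (h := fun _ => ‖v - w‖)
    (by fun_prop) continuous_const ?_ x
  filter_upwards [ae_abs_sub_le_norm v w, hvg, hwh] with y h1 h2 h3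
  rwa [h2, h3] at h1

theorem valueAt_mem_Icc {θ : ℝ} {v : E k d} (hv : HasContRep v) (h : v ∈ tube k d θ) (x : X d) :
    valueAt v x ∈ Icc 0 θ := by
  obtain ⟨g, hg, hvg⟩ := hv
  rw [valueAt_eq hg hvg]
  refine ⟨forall_le_of_ae_le (g := fun _ => 0) continuous_const hg ?_ x,
    forall_le_of_ae_le (h := fun _ => θ) hg continuous_const ?_ x⟩
  · filter_upwards [h, hvg] with y h1 h2; rw [← h2]; exact h1.1
  · filter_upwards [h, hvg] with y h1 h2; rw [← h2]; exact h1.2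

/-- A translation invariant element of `E` is constant. -/
theorem exists_eq_constE_of_translate_eq {v : E k d} (h : ∀ y, translate y v = v) :
    ∃ c, v = constE k d c := by
  obtain ⟨g, -, hvg, hmod⟩ := exists_uniformContinuous_rep (v := v) (ω := fun _ => 0)
    tendsto_const_nhds (fun y => by rw [h y, sub_self, norm_zero])
  refine ⟨g 0, E_ext ?_⟩
  filter_upwards [hvg, ev_const (k := k) (d := d) (g 0)] with x h1 h2
  rw [h1, h2]
  have := hmod x x
  rw [sub_self] at this
  linarith [abs_nonpos_iff.1 this]

/-! ### The right-hand side of the equation and its Euler scheme -/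

/-- The standing assumptions on the kernel `a` and the operator `G`, apart from the positivity of
`a` near the origin. The constants are the Lipschitz constant `l` of `G` on the order interval
`[0, θ]` and the constant `p` of the monotonicity condition. -/
structure Reaction (κ m θ l p : ℝ) (a : X d → ℝ) (G : E k d → E k d) : Prop where
  κ_pos : 0 < κ
  m_pos : 0 < m
  θ_pos : 0 < θ
  a_int : Integrable a
  a_nonneg : ∀ᵐ x, 0 ≤ a x
  a_one : ∫ x, a x = 1
  a_moment : Integrable fun y : X d => ‖y‖ * a y
  β_pos : 0 < κ - m
  G_zero : G (constE k d 0) = constE k d 0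
  G_top : G (constE k d θ) = constE k d (κ - m)
  G_nonneg : ∀ v ∈ tube k d θ, LEae (constE k d 0) (G v)
  G_le : ∀ v ∈ tube k d θ, LEae (G v) (constE k d (κ - m))
  l_pos : 0 < l
  G_lip : ∀ v ∈ tube k d θ, ∀ w ∈ tube k d θ, ‖G v - G w‖ ≤ l * ‖v - w‖
  p_nonneg : 0 ≤ p
  mono : ∀ v ∈ tube k d θ, ∀ w ∈ tube k d θ, LEae v w →
      ∀ᵐ x, κ * conv a (ev v) x - ev v x * ev (G v) x + p * ev v x
        ≤ κ * conv a (ev w) x - ev w x * ev (G w) x + p * ev w x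
  G_cont : ∀ (v : ℕ → E k d) (w : E k d), (∀ n, v n ∈ tube k d θ) → w ∈ tube k d θ →
      LocUnif v w → LocUnif (fun n => G (v n)) (G w)
  G_translate : ∀ v ∈ tube k d θ, ∀ y : X d, translate y (G v) = G (translate y v)
  G_const_lt : ∀ r : ℝ, 0 < r → r < θ → ∀ᵐ x, ev (G (constE k d r)) x < κ - m

/-- The right-hand side `κ (a * v) - m v - v (G v)` of the equation as an element of `E`. -/
noncomputable def field (κ m : ℝ) (a : X d → ℝ) (G : E k d → E k d) (v : E k d) : E k d :=
  toE k fun x => κ * conv a (ev v) x - m * ev v x - ev v x * ev (G v) x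

/-- The truncation of `v` at the levels `0` and `θ`, a retraction of `E` onto `tube k d θ`. -/
noncomputable def clampE (θ : ℝ) (v : E k d) : E k d :=
  toE k fun x => min (max (ev v x) 0) θ

theorem ev_clampE (θ : ℝ) (v : E k d) :
    ev (clampE θ v) =ᵐ[volume] fun x => min (max (ev v x) 0) θ :=
  ev_toE (exists_ev_eq_clamp θ v)

theorem norm_clampE_sub_le (θ : ℝ) (v w : E k d) : ‖clampE θ v - clampE θ w‖ ≤ ‖v - w‖ := by
  refine norm_sub_le_of_ae (norm_nonneg _) ?_
  filter_upwards [ev_clampE θ v, ev_clampE θ w, ae_abs_sub_le_norm v w] with x h1 h2 h3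
  rw [h1, h2]
  exact (abs_min_sub_min_le_max _ _ _ _).trans (max_le
    ((abs_max_sub_max_le_max _ _ _ _).trans (max_le h3 (by simp)))
    (by simp))

theorem clampE_mem {θ : ℝ} (hθ : 0 ≤ θ) (v : E k d) : clampE θ v ∈ tube k d θ := by
  filter_upwards [ev_clampE θ v] with x h
  rw [h]
  exact ⟨le_min (le_max_right _ _) hθ, min_le_right _ _⟩

theorem clampE_of_mem {θ : ℝ} {v : E k d} (hv : v ∈ tube k d θ) : clampE θ v = v := by
  refine E_ext ?_
  filter_upwards [ev_clampE θ v, hv] with x h h1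
  rw [h, max_eq_left h1.1, min_eq_left h1.2]

theorem isClosed_tube {θ : ℝ} (hθ : 0 ≤ θ) : IsClosed (tube k d θ) := by
  have h : tube k d θ = {v | clampE θ v = v} :=
    Set.ext fun v => ⟨clampE_of_mem, fun h => by
      rw [← (show clampE θ v = v from h)]; exact clampE_mem hθ v⟩
  rw [h]
  refine isClosed_eq (LipschitzWith.continuous (K := 1) ?_) continuous_id
  exact LipschitzWith.of_dist_le_mul fun v w => by
    rw [dist_eq_norm, dist_eq_norm, NNReal.coe_one, one_mul]; exact norm_clampE_sub_le θ v w

theorem ev_field {a : X d → ℝ} (ha : Integrable a) (κ m : ℝ) (G : E k d → E k d) (v : E k d) :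
    ev (field κ m a G v) =ᵐ[volume]
      fun x => κ * conv a (ev v) x - m * ev v x - ev v x * ev (G v) x := by
  refine ev_toE ?_
  obtain ⟨c, hc⟩ := exists_ev_eq_of_uniformContinuous k (uniformContinuous_conv ha v)
    (C := (∫ y, |a y|) * ‖v‖) (fun x => by
      have := abs_integral_mul_ev_le (ha.comp_sub_left x) v
      rwa [integral_sub_left_eq_self (fun y => |a y|) volume x] at this)
  obtain ⟨z, hz⟩ := exists_ev_eq_mul v (G v)
  refine ⟨κ • c - m • v - z, ?_⟩
  filter_upwards [ev_sub (κ • c - m • v) z, ev_sub (κ • c) (m • v), ev_smul κ c, ev_smul m v,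
    hc, hz] with x h1 h2 h3 h4 h5 h6
  rw [h1, h2, h3, h4, h5, h6]

theorem ev_eulerStep {a : X d → ℝ} (ha : Integrable a) (κ m : ℝ) (G : E k d → E k d) (τ : ℝ)
    (v : E k d) : ev (eulerStep (field κ m a G) τ v) =ᵐ[volume]
      fun x => ev v x + τ * (κ * conv a (ev v) x - m * ev v x - ev v x * ev (G v) x) := by
  filter_upwards [ev_add v (τ • field κ m a G v), ev_smul τ (field κ m a G v),
    ev_field ha κ m G v] with x h1 h2 h3
  rw [eulerStep, h1, h2, h3]

theorem constE_mem_tube {θ r : ℝ} (h0 : 0 ≤ r) (h1 : r ≤ θ) : constE k d r ∈ tube k d θ := by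
  filter_upwards [ev_const (k := k) (d := d) r] with x h
  rw [h]; exact ⟨h0, h1⟩

theorem translate_mem_tube {θ : ℝ} {v : E k d} (hv : v ∈ tube k d θ) (y : X d) :
    translate y v ∈ tube k d θ := by
  have hq := (measurePreserving_sub_right (volume : Measure (X d)) y).quasiMeasurePreserving
  filter_upwards [ev_translate y v, hq.ae hv] with x h1 h2
  rw [h1]; exact h2

theorem translate_constE (y : X d) (r : ℝ) : translate y (constE k d r) = constE k d r := by
  have hq := (measurePreserving_sub_right (volume : Measure (X d)) y).quasiMeasurePreserving
  refine E_ext ?_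
  filter_upwards [ev_translate y (constE k d r), ev_const (k := k) (d := d) r,
    hq.ae (ev_const (k := k) (d := d) r)] with x h1 h2 h3
  rw [h1, h2, h3]

namespace Reaction

variable {κ m θ l p : ℝ} {a : X d → ℝ} {G : E k d → E k d}

theorem integral_abs_a (H : Reaction κ m θ l p a G) : ∫ x, |a x| = 1 := by
  rw [← H.a_one]
  refine integral_congr_ae ?_
  filter_upwards [H.a_nonneg] with x hx using abs_of_nonneg hx

/-- The Lipschitz constant of the right-hand side on `tube k d θ`. -/
def lip (κ m θ l : ℝ) : ℝ := κ + m + (κ - m) + θ * l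

theorem lip_nonneg (H : Reaction κ m θ l p a G) : 0 ≤ lip κ m θ l := by
  rw [lip]
  have := mul_pos H.θ_pos H.l_pos
  linarith [H.κ_pos, H.m_pos, H.β_pos]

theorem G_mem (H : Reaction κ m θ l p a G) {v : E k d} (hv : v ∈ tube k d θ) :
    ∀ᵐ x, 0 ≤ ev (G v) x ∧ ev (G v) x ≤ κ - m := by
  filter_upwards [H.G_nonneg v hv, H.G_le v hv, ev_const (k := k) (d := d) 0,
    ev_const (k := k) (d := d) (κ - m)] with x h1 h2 h3 h4
  rw [h3] at h1; rw [h4] at h2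
  exact ⟨h1, h2⟩

theorem norm_field_sub_le (H : Reaction κ m θ l p a G) (v : E k d) (hv : v ∈ tube k d θ)
    (w : E k d) (hw : w ∈ tube k d θ) :
    ‖field κ m a G v - field κ m a G w‖ ≤ lip κ m θ l * ‖v - w‖ := by
  refine norm_sub_le_of_ae (mul_nonneg H.lip_nonneg (norm_nonneg _)) ?_
  filter_upwards [ev_field H.a_int κ m G v, ev_field H.a_int κ m G w, ae_abs_sub_le_norm v w,
    ae_abs_sub_le_norm (G v) (G w), H.G_mem hv, hw] with x h1 h2 h3 h4 h5 h6
  rw [h1, h2]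
  have hc := abs_conv_sub_le H.a_int v w x
  rw [H.integral_abs_a, one_mul] at hc
  have hl := h4.trans (H.G_lip v hv w hw)
  have hN := norm_nonneg (v - w)
  have e : κ * conv a (ev v) x - m * ev v x - ev v x * ev (G v) x -
      (κ * conv a (ev w) x - m * ev w x - ev w x * ev (G w) x) =
      κ * (conv a (ev v) x - conv a (ev w) x) - m * (ev v x - ev w x) -
      (ev v x - ev w x) * ev (G v) x - ev w x * (ev (G v) x - ev (G w) x) := by ring
  rw [e]
  have b1 : |κ * (conv a (ev v) x - conv a (ev w) x)| ≤ κ * ‖v - w‖ := by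
    rw [abs_mul, abs_of_pos H.κ_pos]; exact mul_le_mul_of_nonneg_left hc H.κ_pos.le
  have b2 : |m * (ev v x - ev w x)| ≤ m * ‖v - w‖ := by
    rw [abs_mul, abs_of_pos H.m_pos]; exact mul_le_mul_of_nonneg_left h3 H.m_pos.le
  have b3 : |(ev v x - ev w x) * ev (G v) x| ≤ ‖v - w‖ * (κ - m) := by
    rw [abs_mul, abs_of_nonneg h5.1]; exact mul_le_mul h3 h5.2 h5.1 hN
  have b4 : |ev w x * (ev (G v) x - ev (G w) x)| ≤ θ * (l * ‖v - w‖) := by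
    rw [abs_mul, abs_of_nonneg h6.1]; exact mul_le_mul h6.2 hl (abs_nonneg _) H.θ_pos.le
  rw [lip]
  rw [abs_le] at *
  constructor <;> nlinarith

theorem eulerStep_const (H : Reaction κ m θ l p a G) (τ : ℝ) {r c : ℝ}
    (hc : G (constE k d r) = constE k d c) :
    eulerStep (field κ m a G) τ (constE k d r) = constE k d (r + τ * (r * (κ - m - c))) := by
  refine E_ext ?_
  filter_upwards [ev_eulerStep H.a_int κ m G τ (constE k d r), ev_const (k := k) (d := d) r,
    ev_const (k := k) (d := d) c, ev_const (k := k) (d := d) (r + τ * (r * (κ - m - c)))]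
    with x h1 h2 h3 h4
  rw [h1, h4, conv_const H.a_one, h2, hc, h3]
  ring

theorem eulerStep_zero (H : Reaction κ m θ l p a G) (τ : ℝ) :
    eulerStep (field κ m a G) τ (constE k d 0) = constE k d 0 := by
  rw [H.eulerStep_const τ H.G_zero]; simp

theorem eulerStep_top (H : Reaction κ m θ l p a G) (τ : ℝ) :
    eulerStep (field κ m a G) τ (constE k d θ) = constE k d θ := by
  rw [H.eulerStep_const τ H.G_top]; simp

/-- The Euler steps of size at most `1 / (m + p)` preserve the order. -/
theorem eulerStep_mono (H : Reaction κ m θ l p a G) {τ : ℝ} (hτ : 0 ≤ τ) (hτ1 : τ * (m + p) ≤ 1)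
    {v w : E k d} (hv : v ∈ tube k d θ) (hw : w ∈ tube k d θ) (hvw : LEae v w) :
    LEae (eulerStep (field κ m a G) τ v) (eulerStep (field κ m a G) τ w) := by
  filter_upwards [ev_eulerStep H.a_int κ m G τ v, ev_eulerStep H.a_int κ m G τ w,
    H.mono v hv w hw hvw, hvw] with x h1 h2 h3 h4
  rw [h1, h2]
  have := mul_le_mul_of_nonneg_left h3 hτ
  have := mul_le_mul_of_nonneg_left h4 (sub_nonneg.2 hτ1)
  linarith

theorem eulerStep_mem (H : Reaction κ m θ l p a G) {τ : ℝ} (hτ : 0 ≤ τ) (hτ1 : τ * (m + p) ≤ 1)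
    {v : E k d} (hv : v ∈ tube k d θ) : eulerStep (field κ m a G) τ v ∈ tube k d θ := by
  have z := constE_mem_tube (k := k) (d := d) le_rfl H.θ_pos.le
  have t := constE_mem_tube (k := k) (d := d) H.θ_pos.le le_rfl
  have h1 := H.eulerStep_mono hτ hτ1 z hv (by
    filter_upwards [hv, ev_const (k := k) (d := d) 0] with x h h'; rw [h']; exact h.1)
  have h2 := H.eulerStep_mono hτ hτ1 hv t (by
    filter_upwards [hv, ev_const (k := k) (d := d) θ] with x h h'; rw [h']; exact h.2)
  rw [H.eulerStep_zero] at h1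
  rw [H.eulerStep_top] at h2
  filter_upwards [h1, h2, ev_const (k := k) (d := d) 0, ev_const (k := k) (d := d) θ]
    with x e1 e2 e3 e4
  rw [e3] at e1; rw [e4] at e2
  exact ⟨e1, e2⟩

theorem eulerStep_translate (H : Reaction κ m θ l p a G) (τ : ℝ) {v : E k d}
    (hv : v ∈ tube k d θ) (y : X d) :
    eulerStep (field κ m a G) τ (translate y v) =
      translate y (eulerStep (field κ m a G) τ v) := by
  have hq := (measurePreserving_sub_right (volume : Measure (X d)) y).quasiMeasurePreserving
  refine E_ext ?_
  filter_upwards [ev_eulerStep H.a_int κ m G τ (translate y v),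
    ev_translate y (eulerStep (field κ m a G) τ v),
    hq.ae (ev_eulerStep H.a_int κ m G τ v), ev_translate y v, ev_translate y (G v)]
    with x h1 h2 h3 h4 h5
  rw [h1, h2, h3, h4, ← H.G_translate v hv y, h5, conv_translate]

theorem exists_G_const (H : Reaction κ m θ l p a G) {r : ℝ} (h0 : 0 ≤ r) (h1 : r ≤ θ) :
    ∃ c, G (constE k d r) = constE k d c :=
  exists_eq_constE_of_translate_eq fun y => by
    rw [H.G_translate _ (constE_mem_tube h0 h1), translate_constE]

/-- Convolution with `a` is continuous for the locally uniform convergence on bounded sets. The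
part of the kernel far from the origin is controlled by the first moment. -/
theorem locUnif_conv (H : Reaction κ m θ l p a G) {v : ℕ → E k d} {w : E k d}
    (hv : ∀ n, v n ∈ tube k d θ) (hw : w ∈ tube k d θ) (h : LocUnif v w) {K : Set (X d)}
    (hK : IsCompact K) {ε : ℝ} (hε : 0 < ε) :
    ∀ᶠ n in atTop, ∀ x ∈ K, |conv a (ev (v n)) x - conv a (ev w) x| ≤ ε := by
  obtain ⟨R, hR⟩ := hK.isBounded.exists_norm_le
  set A := ∫ y, ‖y‖ * a y with hA
  have hA0 : 0 ≤ A := integral_nonneg_of_ae (by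
    filter_upwards [H.a_nonneg] with y hy using mul_nonneg (norm_nonneg _) hy)
  set M := 2 * θ * A / ε + 1 with hM
  have hθ := H.θ_pos
  have hMpos : 0 < M := by positivity
  filter_upwards [h (Metric.closedBall 0 (R + M)) (isCompact_closedBall _ _) (ε / 2) (half_pos hε)]
    with n hn x hx
  rw [conv_eq_swap, conv_eq_swap]
  have hq := quasiMeasurePreserving_sub_left (volume : Measure (X d)) x
  have i : ∀ z : E k d, Integrable fun y => a y * ev z (x - y) := fun z => by
    have := (integrable_conv H.a_int z x).comp_sub_left x
    simpa using this
  rw [← integral_sub (i _) (i _), ← Real.norm_eq_abs]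
  have hb : ∀ᵐ y, ‖a y * ev (v n) (x - y) - a y * ev w (x - y)‖ ≤
      ε / 2 * a y + θ / M * (‖y‖ * a y) := by
    filter_upwards [hq.ae hn, hq.ae (hv n), hq.ae hw, H.a_nonneg] with y h1 h2 h3 h4
    rw [← mul_sub, norm_mul, Real.norm_of_nonneg h4, Real.norm_eq_abs]
    rcases le_or_gt ‖y‖ M with hy | hy
    · have h5 := h1 (by
        rw [mem_closedBall_zero_iff]
        exact (norm_sub_le _ _).trans (add_le_add (hR x hx) hy))
      have h6 : 0 ≤ θ / M * (‖y‖ * a y) := by positivity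
      nlinarith [mul_le_mul_of_nonneg_left h5 h4]
    · have h5 : |ev (v n) (x - y) - ev w (x - y)| ≤ θ := by
        rw [abs_le]; constructor <;> linarith [h2.1, h2.2, h3.1, h3.2]
      have h6 : θ ≤ θ / M * ‖y‖ := by
        rw [div_mul_eq_mul_div, le_div_iff₀ hMpos]
        exact mul_le_mul_of_nonneg_left hy.le hθ.le
      have h7 : 0 ≤ ε / 2 * a y := by positivity
      nlinarith [mul_le_mul_of_nonneg_left (h5.trans h6) h4]
  refine (norm_integral_le_of_norm_le
    ((H.a_int.const_mul _).add (H.a_moment.const_mul _)) hb).trans ?_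
  rw [integral_add' (H.a_int.const_mul _) (H.a_moment.const_mul _), integral_const_mul,
    integral_const_mul, H.a_one, ← hA]
  have : θ / M * A ≤ ε / 2 := by
    rw [div_mul_eq_mul_div, div_le_iff₀ hMpos, hM]
    have : ε / 2 * (2 * θ * A / ε + 1) = θ * A + ε / 2 := by field_simp
    linarith
  linarith

theorem eulerStep_locUnif (H : Reaction κ m θ l p a G) (τ : ℝ) (hτ : 0 ≤ τ) {v : ℕ → E k d}
    {w : E k d} (hv : ∀ n, v n ∈ tube k d θ) (hw : w ∈ tube k d θ) (h : LocUnif v w) :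
    LocUnif (fun n => eulerStep (field κ m a G) τ (v n)) (eulerStep (field κ m a G) τ w) := by
  intro K hK ε hε
  have hθ := H.θ_pos
  have hκ := H.κ_pos
  have hm := H.m_pos
  have hβ := H.β_pos
  set D := 1 + τ * (κ + m + (κ - m) + θ) with hD
  have hDpos : 0 < D := by positivity
  have hε' : 0 < ε / D := by positivity
  filter_upwards [h K hK _ hε', H.locUnif_conv hv hw h hK hε', H.G_cont v w hv hw h K hK _ hε']
    with n h1 h2 h3
  filter_upwards [h1, h3, ev_eulerStep H.a_int κ m G τ (v n), ev_eulerStep H.a_int κ m G τ w,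
    H.G_mem (hv n), hw] with x e1 e3 e4 e5 e6 e7 hx
  have e1 := e1 hx
  have e2 := h2 x hx
  have e3 := e3 hx
  rw [e4, e5]
  have e : ev (v n) x + τ * (κ * conv a (ev (v n)) x - m * ev (v n) x -
        ev (v n) x * ev (G (v n)) x) -
      (ev w x + τ * (κ * conv a (ev w) x - m * ev w x - ev w x * ev (G w) x)) =
      (ev (v n) x - ev w x) + τ * (κ * (conv a (ev (v n)) x - conv a (ev w) x) -
        m * (ev (v n) x - ev w x) - (ev (v n) x - ev w x) * ev (G (v n)) x -
        ev w x * (ev (G (v n)) x - ev (G w) x)) := by ring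
  rw [e]
  set q := ε / D with hq
  have b1 : |κ * (conv a (ev (v n)) x - conv a (ev w) x)| ≤ κ * q := by
    rw [abs_mul, abs_of_pos hκ]; exact mul_le_mul_of_nonneg_left e2 hκ.le
  have b2 : |m * (ev (v n) x - ev w x)| ≤ m * q := by
    rw [abs_mul, abs_of_pos hm]; exact mul_le_mul_of_nonneg_left e1 hm.le
  have b3 : |(ev (v n) x - ev w x) * ev (G (v n)) x| ≤ q * (κ - m) := by
    rw [abs_mul, abs_of_nonneg e6.1]; exact mul_le_mul e1 e6.2 e6.1 hε'.le
  have b4 : |ev w x * (ev (G (v n)) x - ev (G w) x)| ≤ θ * q := by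
    rw [abs_mul, abs_of_nonneg e7.1]; exact mul_le_mul e7.2 e3 (abs_nonneg _) hθ.le
  have b5 : |κ * (conv a (ev (v n)) x - conv a (ev w) x) -
        m * (ev (v n) x - ev w x) - (ev (v n) x - ev w x) * ev (G (v n)) x -
        ev w x * (ev (G (v n)) x - ev (G w) x)| ≤ (κ + m + (κ - m) + θ) * q := by
    rw [abs_le] at *
    constructor <;> nlinarith
  have b6 := abs_add_le (ev (v n) x - ev w x) (τ * (κ * (conv a (ev (v n)) x - conv a (ev w) x) -
        m * (ev (v n) x - ev w x) - (ev (v n) x - ev w x) * ev (G (v n)) x -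
        ev w x * (ev (G (v n)) x - ev (G w) x)))
  rw [abs_mul, abs_of_nonneg hτ] at b6
  have b7 : D * q = ε := by rw [hq]; field_simp
  have b8 := mul_le_mul_of_nonneg_left b5 hτ
  calc _ ≤ _ := b6
    _ ≤ q + τ * ((κ + m + (κ - m) + θ) * q) := add_le_add e1 b8
    _ = D * q := by rw [hD]; ring
    _ = ε := b7

end Reaction

/-! ### A travelling subsolution of the linearized equation -/

/-- The profile `h ↦ min(R, h⁺)` of the travelling subsolution. -/
def ramp (R h : ℝ) : ℝ := min R (max h 0)

theorem ramp_nonneg {R : ℝ} (hR : 0 ≤ R) (h : ℝ) : 0 ≤ ramp R h := le_min hR (le_max_right _ _)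

theorem ramp_le (R h : ℝ) : ramp R h ≤ R := min_le_left _ _

theorem ramp_of_nonpos {R : ℝ} (hR : 0 ≤ R) {h : ℝ} (hh : h ≤ 0) : ramp R h = 0 := by
  rw [ramp, max_eq_right hh, min_eq_right hR]

theorem ramp_of_le {R h : ℝ} (hR : 0 ≤ R) (hh : R ≤ h) : ramp R h = R := by
  rw [ramp, max_eq_left (hR.trans hh), min_eq_left hh]

theorem lipschitzWith_ramp (R : ℝ) : LipschitzWith 1 (ramp R) :=
  (LipschitzWith.id.max_const 0).const_min R

theorem continuous_ramp (R : ℝ) : Continuous (ramp R) := (lipschitzWith_ramp R).continuous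

theorem abs_ramp_sub_le (R x y : ℝ) : |ramp R x - ramp R y| ≤ |x - y| := by
  have := (lipschitzWith_ramp R).dist_le_mul x y
  rwa [Real.dist_eq, Real.dist_eq, NNReal.coe_one, one_mul] at this

theorem abs_inner_le_norm_of_unit {ξ : X d} (hξ : ‖ξ‖ = 1) (y : X d) : |inner ℝ y ξ| ≤ ‖y‖ := by
  have := abs_real_inner_le_norm y ξ
  rwa [hξ, mul_one] at this

theorem tendsto_integral_tail {a : X d → ℝ} (ha : Integrable a) (ha0 : ∀ᵐ x, 0 ≤ a x)
    (ha1 : Integrable fun y : X d => ‖y‖ * a y) :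
    Tendsto (fun n : ℕ => ∫ y, a y * max (‖y‖ - n) 0) atTop (𝓝 0) := by
  have h := tendsto_integral_of_dominated_convergence (μ := (volume : Measure (X d)))
    (F := fun (n : ℕ) y => a y * max (‖y‖ - n) 0) (f := fun _ => (0 : ℝ))
    (fun y => ‖y‖ * a y)
    (fun n => ha.aestronglyMeasurable.mul
      (by fun_prop : Continuous fun y : X d => max (‖y‖ - (n : ℝ)) 0).aestronglyMeasurable)
    ha1 (fun n => by
      filter_upwards [ha0] with y hy
      rw [norm_mul, Real.norm_of_nonneg hy, Real.norm_of_nonneg (le_max_right _ _), mul_comm]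
      refine mul_le_mul_of_nonneg_right (max_le ?_ (norm_nonneg _)) hy
      linarith [(Nat.cast_nonneg n : (0 : ℝ) ≤ n)])
    (Eventually.of_forall fun y => by
      refine tendsto_const_nhds.congr' ?_
      filter_upwards [eventually_ge_atTop ⌈‖y‖⌉₊] with n hn
      have : ‖y‖ ≤ n := (Nat.le_ceil _).trans (Nat.cast_le.2 hn)
      rw [max_eq_right (by linarith), mul_zero])
  simpa using h

/-- The mass that `a` puts on the half space opposite to `ξ` is bounded below uniformly in the
direction `ξ`. -/
theorem le_integral_neg_part {a : X d → ℝ} (ha : Integrable a) (ha0 : ∀ᵐ x, 0 ≤ a x)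
    (ha1 : Integrable fun y : X d => ‖y‖ * a y) {ρ : ℝ} (hρ : 0 < ρ)
    (haρ : ∀ᵐ x, x ∈ Metric.ball (0 : X d) ρ → ρ ≤ a x) {ξ : X d} (hξ : ‖ξ‖ = 1) {h : ℝ}
    (hh : h ≤ ρ / 4) :
    volume.real (Metric.ball (0 : X d) (ρ / 4)) * (ρ * (ρ / 4)) ≤
      ∫ y, a y * max (-(h + inner ℝ y ξ)) 0 := by
  set c : X d := (-(3 * ρ / 4)) • ξ with hc
  have hball : volume.real (Metric.ball c (ρ / 4)) =
      volume.real (Metric.ball (0 : X d) (ρ / 4)) := by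
    rw [measureReal_def, measureReal_def, Measure.addHaar_ball_center]
  have hci : inner ℝ c ξ = -(3 * ρ / 4) := by
    rw [hc, inner_smul_left, real_inner_self_eq_norm_sq, hξ]; simp
  have hcn : ‖c‖ = 3 * ρ / 4 := by
    rw [hc, norm_smul, hξ, mul_one, norm_neg, Real.norm_of_nonneg (by positivity)]
  rw [← hball, ← smul_eq_mul (a := volume.real _), ← integral_indicator_const _ measurableSet_ball]
  refine integral_mono_ae ?_ ?_ ?_
  · exact (integrable_indicator_iff measurableSet_ball).2
      (integrableOn_const measure_ball_lt_top.ne)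
  · refine ((ha.const_mul |h|).add ha1).mono' (ha.aestronglyMeasurable.mul
      (by fun_prop : Continuous fun y : X d => max (-(h + inner ℝ y ξ)) 0).aestronglyMeasurable) ?_
    filter_upwards [ha0] with y hy
    rw [norm_mul, Real.norm_of_nonneg hy, Real.norm_of_nonneg (le_max_right _ _)]
    have h1 := abs_le.1 (abs_inner_le_norm_of_unit hξ y)
    have h2 : max (-(h + inner ℝ y ξ)) 0 ≤ |h| + ‖y‖ :=
      max_le (by linarith [neg_abs_le h]) (by positivity)
    calc _ ≤ a y * (|h| + ‖y‖) := mul_le_mul_of_nonneg_left h2 hy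
      _ = _ := by simp only [Pi.add_apply]; ring
  · filter_upwards [ha0, haρ] with y hy hyρ
    by_cases hmem : y ∈ Metric.ball c (ρ / 4)
    · rw [indicator_of_mem hmem]
      have hd : ‖y - c‖ < ρ / 4 := by rwa [mem_ball_iff_norm] at hmem
      have h1 := abs_le.1 (abs_inner_le_norm_of_unit hξ (y - c))
      rw [inner_sub_left, hci] at h1
      have h2 : ρ / 4 ≤ max (-(h + inner ℝ y ξ)) 0 := le_max_of_le_left (by linarith [h1.2])
      have h3 : ρ ≤ a y := hyρ (by
        rw [mem_ball_zero_iff]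
        have := norm_le_norm_add_norm_sub' y c
        linarith)
      exact mul_le_mul h3 h2 (by positivity) hy
    · rw [indicator_of_notMem hmem]
      exact mul_nonneg hy (le_max_right _ _)

/-- For each direction `ξ`, the linear equation `∂u/∂t = κ (a * u) - (κ - γ) u` with `γ > 0` has the
subsolution `u(x, t) = min(R, (c t - x · ξ)⁺)` with a speed `c` exceeding that of the mean drift
by some `δ > 0`, even for each Euler step. Near the front the excess speed `δ` is paid for by the
jumps of the kernel in the direction `-ξ`, which the positive part does not count as a loss, and
further behind by the growth rate `γ`. The numbers `δ` and `R` do not depend on `ξ`. -/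
theorem exists_travelling_ramp {κ γ : ℝ} (hκ : 0 < κ) (hγ : 0 < γ) {a : X d → ℝ}
    (ha : Integrable a) (ha0 : ∀ᵐ x, 0 ≤ a x) (haone : ∫ x, a x = 1)
    (ha1 : Integrable fun y : X d => ‖y‖ * a y) {ρ : ℝ} (hρ : 0 < ρ)
    (haρ : ∀ᵐ x, x ∈ Metric.ball (0 : X d) ρ → ρ ≤ a x) :
    ∃ δ > 0, ∃ R > 0, ∀ ξ : X d, ‖ξ‖ = 1 → ∀ τ, 0 ≤ τ → τ * κ ≤ 1 → ∀ h : ℝ,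
      ramp R (h + τ * (κ * (∫ y, a y * inner ℝ y ξ) + δ)) ≤
        ramp R h + τ * (κ * (∫ y, a y * ramp R (h + inner ℝ y ξ)) - (κ - γ) * ramp R h) := by
  set e₀ := volume.real (Metric.ball (0 : X d) (ρ / 4)) * (ρ * (ρ / 4)) with he₀
  have he₀pos : 0 < e₀ := by
    have : 0 < volume.real (Metric.ball (0 : X d) (ρ / 4)) :=
      ENNReal.toReal_pos (Metric.measure_ball_pos _ _ (by positivity)).ne' measure_ball_lt_top.ne
    positivity
  set δ := min (κ * e₀ / 2) (γ * ρ / 8) with hδ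
  have hδpos : 0 < δ := lt_min (by positivity) (by positivity)
  have hδ1 : 2 * δ ≤ κ * e₀ := by linarith [min_le_left (κ * e₀ / 2) (γ * ρ / 8)]
  have hδ2 : 2 * δ / γ ≤ ρ / 4 := by
    rw [div_le_iff₀ hγ]; linarith [min_le_right (κ * e₀ / 2) (γ * ρ / 8)]
  set A := ∫ y, ‖y‖ * a y with hA
  have hA0 : 0 ≤ A := integral_nonneg_of_ae (by
    filter_upwards [ha0] with y hy using mul_nonneg (norm_nonneg _) hy)
  have hev : ∀ᶠ n : ℕ in atTop, (∫ y, a y * max (‖y‖ - n) 0) < δ / κ :=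
    (tendsto_integral_tail ha ha0 ha1).eventually (gt_mem_nhds (by positivity))
  obtain ⟨n, hn, hn2⟩ := (hev.and (eventually_ge_atTop (⌈(2 * κ * A + δ) / γ⌉₊ + 1))).exists
  have hnn : (2 * κ * A + δ) / γ + 1 ≤ n := by
    have h1 := Nat.le_ceil ((2 * κ * A + δ) / γ)
    have h2 : ((⌈(2 * κ * A + δ) / γ⌉₊ + 1 : ℕ) : ℝ) ≤ n := Nat.cast_le.2 hn2
    push_cast at h2
    linarith
  have hq : 0 ≤ (2 * κ * A + δ) / γ := by positivity
  have hn0 : (0 : ℝ) < n := by linarith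
  have hnγ : 2 * κ * A + δ ≤ γ * n := by
    have h1 : (2 * κ * A + δ) / γ ≤ n := by linarith
    rw [div_le_iff₀ hγ] at h1; linarith
  set T := ∫ y, a y * max (‖y‖ - n) 0 with hT
  have hκT : κ * T ≤ δ := by
    have h1 := (lt_div_iff₀ hκ).1 hn
    linarith
  set R : ℝ := 2 * n with hR
  have hRpos : 0 < R := by positivity
  refine ⟨δ, hδpos, R, hRpos, fun ξ hξ τ hτ hτκ h => ?_⟩
  set M := ∫ y, a y * inner ℝ y ξ with hM
  have dom : ∀ (f : X d → ℝ) (C : ℝ), Continuous f → (∀ y, |f y| ≤ C + ‖y‖) →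
      Integrable fun y => a y * f y := by
    intro f C hf hb
    refine ((ha.const_mul C).add ha1).mono'
      (ha.aestronglyMeasurable.mul hf.aestronglyMeasurable) ?_
    filter_upwards [ha0] with y hy
    rw [norm_mul, Real.norm_of_nonneg hy, Real.norm_eq_abs]
    calc _ ≤ a y * (C + ‖y‖) := mul_le_mul_of_nonneg_left (hb y) hy
      _ = _ := by simp only [Pi.add_apply]; ring
  have hin := fun y : X d => abs_inner_le_norm_of_unit hξ y
  have iY : Integrable fun y => a y * inner ℝ y ξ :=
    dom _ 0 (by fun_prop) fun y => by rw [zero_add]; exact hin y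
  have iR : Integrable fun y => a y * ramp R (h + inner ℝ y ξ) :=
    dom _ R ((continuous_ramp R).comp (by fun_prop)) fun y => by
      rw [abs_of_nonneg (ramp_nonneg hRpos.le _)]
      linarith [ramp_le R (h + inner ℝ y ξ), norm_nonneg y]
  have iN : Integrable fun y => a y * max (-(h + inner ℝ y ξ)) 0 :=
    dom _ |h| (by fun_prop) fun y => by
      rw [abs_of_nonneg (le_max_right _ _)]
      exact max_le (by linarith [(abs_le.1 (hin y)).1, neg_abs_le h]) (by positivity)
  have iT : Integrable fun y => a y * max (‖y‖ - n) 0 :=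
    dom _ 0 (by fun_prop) fun y => by
      rw [abs_of_nonneg (le_max_right _ _), zero_add]
      exact max_le (by linarith) (norm_nonneg _)
  have hMA : |M| ≤ A := by
    rw [hA, hM, ← Real.norm_eq_abs]
    refine norm_integral_le_of_norm_le ha1 ?_
    filter_upwards [ha0] with y hy
    rw [norm_mul, Real.norm_of_nonneg hy, mul_comm, Real.norm_eq_abs]
    exact mul_le_mul_of_nonneg_right (hin y) hy
  set J := ∫ y, a y * ramp R (h + inner ℝ y ξ) with hJ
  set N := ∫ y, a y * max (-(h + inner ℝ y ξ)) 0 with hN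
  have hJ0 : 0 ≤ J := integral_nonneg_of_ae (by
    filter_upwards [ha0] with y hy using mul_nonneg hy (ramp_nonneg hRpos.le _))
  have hN0 : 0 ≤ N := integral_nonneg_of_ae (by
    filter_upwards [ha0] with y hy using mul_nonneg hy (le_max_right _ _))
  have hτγ : τ * (κ - γ) ≤ 1 := by nlinarith
  have hg0 := ramp_nonneg hRpos.le h
  rcases le_or_gt (R / 2) h with hlarge | hsmall
  · -- far behind the front the growth dominates the transport
    have hJA : ramp R h - A ≤ J := by
      have e : ramp R h - A = ∫ y, (a y * ramp R h - ‖y‖ * a y) := by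
        rw [integral_sub (ha.mul_const _) ha1, integral_mul_const, haone, one_mul]
      rw [e]
      refine integral_mono_ae ((ha.mul_const _).sub ha1) iR ?_
      filter_upwards [ha0] with y hy
      have h1 : |ramp R (h + inner ℝ y ξ) - ramp R h| ≤ ‖y‖ :=
        (abs_ramp_sub_le R _ h).trans (by rw [add_sub_cancel_left]; exact hin y)
      have := mul_le_mul_of_nonneg_left (abs_le.1 h1).1 hy
      linarith
    have hgR : R / 2 ≤ ramp R h := le_min (by linarith) (hlarge.trans (le_max_left _ _))
    have h1 := (abs_le.1 (abs_ramp_sub_le R (h + τ * (κ * M + δ)) h)).2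
    rw [add_sub_cancel_left, abs_mul, abs_of_nonneg hτ] at h1
    have h2 : |κ * M + δ| ≤ κ * A + δ := by
      refine (abs_add_le _ _).trans ?_
      rw [abs_mul, abs_of_pos hκ, abs_of_pos hδpos]
      linarith [mul_le_mul_of_nonneg_left hMA hκ.le]
    have h3 : κ * A + δ ≤ κ * J - (κ - γ) * ramp R h := by
      have := mul_le_mul_of_nonneg_left hJA hκ.le
      have := mul_le_mul_of_nonneg_left hgR hγ.le
      have e : γ * (R / 2) = γ * n := by rw [hR]; ring
      linarith
    have := mul_le_mul_of_nonneg_left (h2.trans h3) hτ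
    linarith
  rcases le_or_gt (h + τ * (κ * M + δ)) 0 with hneg | hpos
  · rw [ramp_of_nonpos hRpos.le hneg]
    have := mul_nonneg (sub_nonneg.2 hτγ) hg0
    have := mul_nonneg hτ (mul_nonneg hκ.le hJ0)
    linarith
  -- near the front the positive part gains from the jumps across the front
  have hJN : h + M + N - T ≤ J := by
    have i1 : Integrable fun y => a y * h + a y * inner ℝ y ξ := (ha.mul_const h).add iY
    have i2 : Integrable fun y => a y * h + a y * inner ℝ y ξ +
        a y * max (-(h + inner ℝ y ξ)) 0 := i1.add iN
    have e : h + M + N - T = ∫ y, (a y * h + a y * inner ℝ y ξ +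
        a y * max (-(h + inner ℝ y ξ)) 0 - a y * max (‖y‖ - n) 0) := by
      rw [integral_sub i2 iT, integral_add i1 iN, integral_add (ha.mul_const _) iY,
        integral_mul_const, haone, one_mul]
    rw [e]
    refine integral_mono_ae (i2.sub iT) iR ?_
    filter_upwards [ha0] with y hy
    have h0 : h + inner ℝ y ξ + max (-(h + inner ℝ y ξ)) 0 - max (‖y‖ - n) 0 ≤
        ramp R (h + inner ℝ y ξ) := by
      have h1 := (abs_le.1 (hin y)).2
      have h2 := le_max_left (‖y‖ - n) 0
      have h3 := le_max_right (‖y‖ - n) 0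
      refine le_min ?_ ?_
      · rcases max_cases (-(h + inner ℝ y ξ)) 0 with ⟨h4, -⟩ | ⟨h4, -⟩ <;> rw [h4] <;> linarith
      · rcases max_cases (-(h + inner ℝ y ξ)) 0 with ⟨h4, -⟩ | ⟨h4, -⟩ <;> rw [h4]
        · exact le_max_of_le_right (by linarith)
        · exact le_max_of_le_left (by linarith)
    have := mul_le_mul_of_nonneg_left h0 hy
    linarith
  have hκJ := mul_le_mul_of_nonneg_left hJN hκ.le
  have htarget : ramp R (h + τ * (κ * M + δ)) ≤ h + τ * (κ * M + δ) :=
    (min_le_right _ _).trans (max_le le_rfl hpos.le)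
  have hfront : h ≤ ρ / 4 → 2 * δ ≤ κ * N := fun hh =>
    hδ1.trans (mul_le_mul_of_nonneg_left (le_integral_neg_part ha ha0 ha1 hρ haρ hξ hh) hκ.le)
  rcases le_or_gt 0 h with h0 | h0
  · have hg : ramp R h = h := by
      rw [ramp, max_eq_left h0, min_eq_right (by linarith)]
    rw [hg]
    have h5 : δ ≤ γ * h + κ * N - κ * T := by
      rcases le_or_gt h (2 * δ / γ) with h6 | h6
      · have := hfront (h6.trans hδ2)
        have := mul_nonneg hγ.le h0
        linarith
      · rw [div_lt_iff₀ hγ] at h6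
        have := mul_nonneg hκ.le hN0
        linarith
    have h7 : κ * M + δ ≤ κ * J - (κ - γ) * h := by linarith
    have := mul_le_mul_of_nonneg_left h7 hτ
    linarith
  · rw [ramp_of_nonpos hRpos.le h0.le]
    have h5 := hfront (by linarith)
    have h7 : κ * M + δ + κ * h ≤ κ * J := by linarith
    have h8 := mul_le_mul_of_nonneg_left h7 hτ
    have h9 : h ≤ τ * κ * h := by nlinarith
    linarith

/-! ### The solution map -/

theorem LEae.trans {u v w : E k d} (h1 : LEae u v) (h2 : LEae v w) : LEae u w := by
  filter_upwards [h1, h2] with x e1 e2 using e1.trans e2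

theorem LEae.of_tendsto {v w : ℕ → E k d} {v₀ w₀ : E k d} (hv : Tendsto v atTop (𝓝 v₀))
    (hw : Tendsto w atTop (𝓝 w₀)) (h : ∀ᶠ n in atTop, LEae (v n) (w n)) : LEae v₀ w₀ := by
  obtain ⟨N, hN⟩ := eventually_atTop.1 h
  have lim : ∀ {z : ℕ → E k d} {z₀ : E k d}, Tendsto z atTop (𝓝 z₀) →
      ∀ᵐ x, Tendsto (fun n => ev (z n) x) atTop (𝓝 (ev z₀ x)) := fun {z z₀} hz => by
    filter_upwards [ae_all_iff.2 fun n => ae_abs_sub_le_norm (z n) z₀] with x hx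
    rw [tendsto_iff_norm_sub_tendsto_zero]
    exact squeeze_zero (fun _ => norm_nonneg _) hx (tendsto_iff_norm_sub_tendsto_zero.1 hz)
  have h2 : ∀ᵐ x, ∀ n, N ≤ n → ev (v n) x ≤ ev (w n) x := by
    refine ae_all_iff.2 fun n => ?_
    by_cases hn : N ≤ n
    · filter_upwards [hN n hn] with x hx _ using hx
    · exact Eventually.of_forall fun x hn' => absurd hn' hn
  filter_upwards [lim hv, lim hw, h2] with x e1 e2 e3
  exact le_of_tendsto_of_tendsto e1 e2 (eventually_atTop.2 ⟨N, e3⟩)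

theorem norm_translate_sub_le (y : X d) (v w : E k d) :
    ‖translate y v - translate y w‖ ≤ ‖v - w‖ := by
  have hq := (measurePreserving_sub_right (volume : Measure (X d)) y).quasiMeasurePreserving
  refine norm_sub_le_of_ae (norm_nonneg _) ?_
  filter_upwards [ev_translate y v, ev_translate y w, hq.ae (ae_abs_sub_le_norm v w)]
    with x h1 h2 h3
  rwa [h1, h2]

namespace Reaction

variable {κ m θ l p : ℝ} {a : X d → ℝ} {G : E k d → E k d}

theorem norm_field_le (H : Reaction κ m θ l p a G) (v : E k d) (hv : v ∈ tube k d θ) :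
    ‖field κ m a G v‖ ≤ lip κ m θ l * θ := by
  have z := constE_mem_tube (k := k) (d := d) le_rfl H.θ_pos.le
  have h0 : field κ m a G (constE k d 0) = 0 := by
    have := H.eulerStep_zero 1
    rwa [eulerStep, one_smul, add_eq_left] at this
  have h1 := H.norm_field_sub_le v hv _ z
  rw [h0, sub_zero] at h1
  refine h1.trans (mul_le_mul_of_nonneg_left ?_ H.lip_nonneg)
  refine norm_sub_le_of_ae H.θ_pos.le ?_
  filter_upwards [hv, ev_const (k := k) (d := d) 0] with x e1 e2
  rw [e2, sub_zero, abs_of_nonneg e1.1]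
  exact e1.2

/-- Global existence of classical solutions with values in `tube k d θ`. -/
theorem exists_solution (H : Reaction κ m θ l p a G) {f : E k d} (hf : f ∈ tube k d θ) :
    ∃ u : ℝ → E k d, IsClassicalSolution κ m a G f u ∧ ∀ s, 0 ≤ s → u s ∈ tube k d θ := by
  set F : E k d → E k d := fun v => field κ m a G (clampE θ v) with hF
  have hcl := clampE_mem (k := k) (d := d) H.θ_pos.le
  have hFl : ∀ v w, ‖F v - F w‖ ≤ lip κ m θ l * ‖v - w‖ := fun v w =>
    (H.norm_field_sub_le _ (hcl v) _ (hcl w)).trans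
      (mul_le_mul_of_nonneg_left (norm_clampE_sub_le θ v w) H.lip_nonneg)
  have hFM : ∀ v, ‖F v‖ ≤ lip κ m θ l * θ := fun v => H.norm_field_le _ (hcl v)
  have hFL : LipschitzWith (lip κ m θ l).toNNReal F := LipschitzWith.of_dist_le_mul fun v w => by
    rw [Real.coe_toNNReal _ H.lip_nonneg, dist_eq_norm, dist_eq_norm]; exact hFl v w
  obtain ⟨u, hu0, hu⟩ := exists_global_solution hFL hFM f
  have hmp : 0 < m + p := add_pos_of_pos_of_nonneg H.m_pos H.p_nonneg
  have hmem : ∀ s, 0 ≤ s → u s ∈ tube k d θ := fun s hs =>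
    solution_mem_of_eulerStep_mem H.lip_nonneg hFl hFM (isClosed_tube H.θ_pos.le)
      (τ₀ := 1 / (m + p)) (by positivity)
      (fun τ h0 h1 v hv => by
        have e : eulerStep F τ v = eulerStep (field κ m a G) τ v := by
          rw [eulerStep, eulerStep, hF]; simp only [clampE_of_mem hv]
        rw [e]
        exact H.eulerStep_mem h0 ((le_div_iff₀ hmp).1 h1) hv)
      hu (by rwa [hu0]) hs
  have hcont : Continuous u := continuous_iff_continuousAt.2 fun t => (hu t).continuousAt
  refine ⟨u, ⟨hu0, hcont.continuousOn, fun t => F (u t),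
    (hFL.continuous.comp hcont).continuousOn, fun t ht => ⟨hu t, ?_⟩⟩, hmem⟩
  have e : F (u t) = field κ m a G (u t) := by simp only [hF, clampE_of_mem (hmem t ht.le)]
  simp only [e]
  exact ev_field H.a_int κ m G (u t)

theorem hasDerivWithinAt_of_classical (H : Reaction κ m θ l p a G) {f : E k d} {u : ℝ → E k d}
    (hu : IsClassicalSolution κ m a G f u) (hmem : ∀ s, 0 ≤ s → u s ∈ tube k d θ) :
    ∀ s, 0 ≤ s → HasDerivWithinAt u (field κ m a G (u s)) (Ici s) s := by
  obtain ⟨-, hc, u', -, hd⟩ := hu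
  have hL : LipschitzOnWith (lip κ m θ l).toNNReal (field κ m a G) (tube k d θ) :=
    LipschitzOnWith.of_dist_le_mul fun v hv w hw => by
      rw [Real.coe_toNNReal _ H.lip_nonneg, dist_eq_norm, dist_eq_norm]
      exact H.norm_field_sub_le v hv w hw
  intro s hs
  refine hasDerivWithinAt_Ici_of_solution hc (hL.continuousOn.comp hc hmem) (fun t ht => ?_) hs
  obtain ⟨h1, h2⟩ := hd t ht
  rwa [E_ext (h2.trans (ev_field H.a_int κ m G (u t)).symm)] at h1

theorem exists_solMap_eq (H : Reaction κ m θ l p a G) {f : E k d} (hf : f ∈ tube k d θ) :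
    ∃ u : ℝ → E k d, IsClassicalSolution κ m a G f u ∧ (∀ s, 0 ≤ s → u s ∈ tube k d θ) ∧
      ∀ t, solMap κ m θ a G t f = u t := by
  have hex := H.exists_solution hf
  exact ⟨hex.choose, hex.choose_spec.1, hex.choose_spec.2, fun t => by rw [solMap, dif_pos hex]⟩

theorem solMap_mem (H : Reaction κ m θ l p a G) {f : E k d} (hf : f ∈ tube k d θ) {t : ℝ}
    (ht : 0 ≤ t) : solMap κ m θ a G t f ∈ tube k d θ := by
  obtain ⟨u, -, hmem, he⟩ := H.exists_solMap_eq hf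
  rw [he]; exact hmem t ht

theorem norm_solMap_sub_le (H : Reaction κ m θ l p a G) {f g : E k d} (hf : f ∈ tube k d θ)
    (hg : g ∈ tube k d θ) {t : ℝ} (ht : 0 ≤ t) :
    ‖solMap κ m θ a G t f - solMap κ m θ a G t g‖ ≤
      Real.exp (lip κ m θ l * t) * ‖f - g‖ := by
  obtain ⟨u, hu, hum, hue⟩ := H.exists_solMap_eq hf
  obtain ⟨w, hw, hwm, hwe⟩ := H.exists_solMap_eq hg
  rw [hue, hwe, mul_comm]
  have h := dist_le_of_trajectories_ODE_of_mem (v := fun _ => field κ m a G)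
    (K := (lip κ m θ l).toNNReal) (s := fun _ => tube k d θ) (f := u) (g := w) (a := 0) (b := t)
    (δ := ‖f - g‖)
    (fun _ _ => LipschitzOnWith.of_dist_le_mul fun v hv w hw => by
      rw [Real.coe_toNNReal _ H.lip_nonneg, dist_eq_norm, dist_eq_norm]
      exact H.norm_field_sub_le v hv w hw)
    (hu.2.1.mono Icc_subset_Ici_self)
    (fun s hs => H.hasDerivWithinAt_of_classical hu hum s hs.1) (fun s hs => hum s hs.1)
    (hw.2.1.mono Icc_subset_Ici_self)
    (fun s hs => H.hasDerivWithinAt_of_classical hw hwm s hs.1) (fun s hs => hwm s hs.1)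
    (by rw [hu.1, hw.1, dist_eq_norm]) t ⟨ht, le_rfl⟩
  rwa [dist_eq_norm, sub_zero, Real.coe_toNNReal _ H.lip_nonneg] at h

/-- The solution map is the limit of the Euler scheme, uniformly in the initial value. -/
theorem norm_solMap_sub_iterate_le (H : Reaction κ m θ l p a G) {t : ℝ} (ht : 0 ≤ t) :
    ∃ C : ℝ, ∀ n : ℕ, 0 < n → t / n * (m + p) ≤ 1 → ∀ f ∈ tube k d θ,
      ‖solMap κ m θ a G t f - (eulerStep (field κ m a G) (t / n))^[n] f‖ ≤ C / n := by
  refine ⟨lip κ m θ l * (lip κ m θ l * θ) * t ^ 2 * Real.exp (lip κ m θ l * t),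
    fun n hn hsmall f hf => ?_⟩
  obtain ⟨u, hu, hum, hue⟩ := H.exists_solMap_eq hf
  rw [hue, ← hu.1]
  exact norm_sub_euler_iterate_le H.lip_nonneg H.norm_field_sub_le H.norm_field_le hum hu.2.1
    (H.hasDerivWithinAt_of_classical hu hum) ht hn
    (fun v hv => H.eulerStep_mem (by positivity) hsmall hv)

theorem eventually_small_step (t q : ℝ) : ∀ᶠ n : ℕ in atTop, 0 < n ∧ t / n * q ≤ 1 := by
  have h : Tendsto (fun n : ℕ => t / n * q) atTop (𝓝 0) := by
    simpa using (tendsto_const_div_atTop_nhds_zero_nat t).mul_const q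
  filter_upwards [eventually_gt_atTop 0, h.eventually (gt_mem_nhds one_pos)] with n h1 h2
    using ⟨h1, h2.le⟩

theorem tendsto_iterate_solMap (H : Reaction κ m θ l p a G) {t : ℝ} (ht : 0 ≤ t) {f : E k d}
    (hf : f ∈ tube k d θ) :
    Tendsto (fun n : ℕ => (eulerStep (field κ m a G) (t / n))^[n] f) atTop
      (𝓝 (solMap κ m θ a G t f)) := by
  obtain ⟨C, hC⟩ := H.norm_solMap_sub_iterate_le ht
  rw [tendsto_iff_norm_sub_tendsto_zero]
  refine squeeze_zero' (Eventually.of_forall fun _ => norm_nonneg _) ?_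
    (tendsto_const_div_atTop_nhds_zero_nat C)
  filter_upwards [eventually_small_step t (m + p)] with n hn
  rw [norm_sub_rev]
  exact hC n hn.1 hn.2 f hf

theorem iterate_mono (H : Reaction κ m θ l p a G) {τ : ℝ} (hτ : 0 ≤ τ) (hτ1 : τ * (m + p) ≤ 1)
    {v w : E k d} (hv : v ∈ tube k d θ) (hw : w ∈ tube k d θ) (hvw : LEae v w) (n : ℕ) :
    LEae ((eulerStep (field κ m a G) τ)^[n] v) ((eulerStep (field κ m a G) τ)^[n] w) := by
  induction n with
  | zero => exact hvw
  | succ n ih =>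
    rw [Function.iterate_succ_apply', Function.iterate_succ_apply']
    have hS : ∀ z ∈ tube k d θ, eulerStep (field κ m a G) τ z ∈ tube k d θ :=
      fun z hz => H.eulerStep_mem hτ hτ1 hz
    exact H.eulerStep_mono hτ hτ1 (iterate_mem_of_mapsTo hS hv n) (iterate_mem_of_mapsTo hS hw n) ih

theorem solMap_mono (H : Reaction κ m θ l p a G) {t : ℝ} (ht : 0 ≤ t) {v w : E k d}
    (hv : v ∈ tube k d θ) (hw : w ∈ tube k d θ) (hvw : LEae v w) :
    LEae (solMap κ m θ a G t v) (solMap κ m θ a G t w) := by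
  refine LEae.of_tendsto (H.tendsto_iterate_solMap ht hv) (H.tendsto_iterate_solMap ht hw) ?_
  filter_upwards [eventually_small_step t (m + p)] with n hn
  exact H.iterate_mono (by positivity) hn.2 hv hw hvw n

theorem solMap_translate (H : Reaction κ m θ l p a G) {t : ℝ} (ht : 0 ≤ t) {v : E k d}
    (hv : v ∈ tube k d θ) (y : X d) :
    solMap κ m θ a G t (translate y v) = translate y (solMap κ m θ a G t v) := by
  have h1 := H.tendsto_iterate_solMap ht (translate_mem_tube hv y)
  have hc : Continuous (translate (k := k) y) := LipschitzWith.continuous (K := 1)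
    (LipschitzWith.of_dist_le_mul fun v w => by
      rw [dist_eq_norm, dist_eq_norm, NNReal.coe_one, one_mul]
      exact norm_translate_sub_le y v w)
  have h2 := (hc.tendsto _).comp (H.tendsto_iterate_solMap ht hv)
  refine tendsto_nhds_unique (h1.congr' ?_) h2
  filter_upwards [eventually_small_step t (m + p)] with n hn
  have hS : ∀ z ∈ tube k d θ, eulerStep (field κ m a G) (t / n) z ∈ tube k d θ :=
    fun z hz => H.eulerStep_mem (by positivity) hn.2 hz
  have key : ∀ j : ℕ, (eulerStep (field κ m a G) (t / n))^[j] (translate y v) =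
      translate y ((eulerStep (field κ m a G) (t / n))^[j] v) := by
    intro j
    induction j with
    | zero => rfl
    | succ j ih =>
      rw [Function.iterate_succ_apply', Function.iterate_succ_apply', ih,
        H.eulerStep_translate _ (iterate_mem_of_mapsTo hS hv j)]
  exact key n

theorem solMap_locUnif (H : Reaction κ m θ l p a G) {t : ℝ} (ht : 0 ≤ t) {v : ℕ → E k d}
    {w : E k d} (hv : ∀ n, v n ∈ tube k d θ) (hw : w ∈ tube k d θ) (h : LocUnif v w) :
    LocUnif (fun n => solMap κ m θ a G t (v n)) (solMap κ m θ a G t w) := by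
  intro K hK ε hε
  obtain ⟨C, hC⟩ := H.norm_solMap_sub_iterate_le ht
  obtain ⟨N, ⟨hN, hN1⟩, hN2⟩ := ((eventually_small_step t (m + p)).and
    ((tendsto_const_div_atTop_nhds_zero_nat C).eventually
      (gt_mem_nhds (by positivity : 0 < ε / 3)))).exists
  have hS : ∀ z ∈ tube k d θ, eulerStep (field κ m a G) (t / N) z ∈ tube k d θ :=
    fun z hz => H.eulerStep_mem (by positivity) hN1 hz
  have key : ∀ j : ℕ, LocUnif (fun n => (eulerStep (field κ m a G) (t / N))^[j] (v n))
      ((eulerStep (field κ m a G) (t / N))^[j] w) := by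
    intro j
    induction j with
    | zero => exact h
    | succ j ih =>
      simp only [Function.iterate_succ_apply']
      exact H.eulerStep_locUnif _ (by positivity) (fun n => iterate_mem_of_mapsTo hS (hv n) j)
        (iterate_mem_of_mapsTo hS hw j) ih
  filter_upwards [key N K hK (ε / 3) (by positivity)] with n hn
  filter_upwards [hn, ae_abs_sub_le_norm (solMap κ m θ a G t (v n)) _,
    ae_abs_sub_le_norm (solMap κ m θ a G t w) _] with x e1 e2 e3 hx
  have e1 := abs_le.1 (e1 hx)
  have e2 := abs_le.1 (e2.trans ((hC N hN hN1 _ (hv n)).trans hN2.le))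
  have e3 := abs_le.1 (e3.trans ((hC N hN hN1 _ hw).trans hN2.le))
  rw [abs_le]
  constructor <;> linarith [e1.1, e1.2, e2.1, e2.2, e3.1, e3.2]

/-- Uniformly continuous initial values are mapped to elements with a continuous representative:
as `Q_t` is Lipschitz and commutes with translations, these act continuously on the image. -/
theorem hasContRep_solMap (H : Reaction κ m θ l p a G) {t : ℝ} (ht : 0 ≤ t) {v : E k d}
    (hv : v ∈ tube k d θ) {g : X d → ℝ} (hg : UniformContinuous g) (hvg : ev v =ᵐ[volume] g) :
    HasContRep (solMap κ m θ a G t v) := by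
  have hT : Tendsto (fun y : X d => ‖translate y v - v‖) (𝓝 0) (𝓝 0) := by
    rw [Metric.tendsto_nhds_nhds]
    intro ε hε
    obtain ⟨η, hη, hg'⟩ := Metric.uniformContinuous_iff.1 hg (ε / 2) (half_pos hε)
    refine ⟨η, hη, fun {y} hy => ?_⟩
    rw [Real.dist_eq, sub_zero, abs_of_nonneg (norm_nonneg _)]
    refine lt_of_le_of_lt (norm_sub_le_of_ae (half_pos hε).le ?_) (half_lt_self hε)
    have hq := (measurePreserving_sub_right (volume : Measure (X d)) y).quasiMeasurePreserving
    filter_upwards [ev_translate y v, hq.ae hvg, hvg] with x h1 h2 h3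
    rw [h1, h2, h3, ← Real.dist_eq]
    refine (hg' ?_).le
    rw [dist_eq_norm]
    simpa using hy
  obtain ⟨g', h1, h2, -⟩ := exists_uniformContinuous_rep
    (v := solMap κ m θ a G t v)
    (ω := fun y => Real.exp (lip κ m θ l * t) * ‖translate y v - v‖)
    (by simpa using hT.const_mul (Real.exp (lip κ m θ l * t)))
    (fun y => by
      rw [← H.solMap_translate ht hv]
      exact H.norm_solMap_sub_le (translate_mem_tube hv y) hv ht)
  exact ⟨g', h1.continuous, h2⟩

/-- Constants between `0` and `θ` are strictly increased by the solution map: for a constant `s`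
near `r` the reaction `β - G s` is bounded away from zero, so that the Euler scheme leaves a
neighbourhood of `r` upwards. -/
theorem exists_const_lt_solMap_const (H : Reaction κ m θ l p a G) {t : ℝ} (ht : 0 < t) {r : ℝ}
    (hr : 0 < r) (hrθ : r < θ) :
    ∃ ρ > r, LEae (constE k d ρ) (solMap κ m θ a G t (constE k d r)) := by
  obtain ⟨c, hc⟩ := H.exists_G_const hr.le hrθ.le
  have hcβ : c < κ - m := by
    have h1 := H.G_const_lt r hr hrθ
    rw [hc] at h1
    obtain ⟨x, h2, h3⟩ := (h1.and (ev_const (k := k) (d := d) c)).exists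
    rwa [h3] at h2
  have hl := H.l_pos
  set η := κ - m - c with hη
  have hηpos : 0 < η := by linarith
  refine ⟨min (r + t * (r * (η / 2))) (r + η / (2 * l)), lt_min ?_ ?_, ?_⟩
  · have : 0 < t * (r * (η / 2)) := by positivity
    linarith
  · have : 0 < η / (2 * l) := by positivity
    linarith
  refine LEae.of_tendsto tendsto_const_nhds
    (H.tendsto_iterate_solMap ht.le (constE_mem_tube hr.le hrθ.le)) ?_
  filter_upwards [eventually_small_step t (m + p)] with n hn
  have hn0 : (0 : ℝ) < n := Nat.cast_pos.2 hn.1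
  set τ := t / n with hτ
  have hτ0 : 0 ≤ τ := by positivity
  have key : ∀ j : ℕ, ∃ s, r ≤ s ∧ s ≤ θ ∧
      min (r + j * τ * (r * (η / 2))) (r + η / (2 * l)) ≤ s ∧
      (eulerStep (field κ m a G) τ)^[j] (constE k d r) = constE k d s := by
    intro j
    induction j with
    | zero => exact ⟨r, le_rfl, hrθ.le, (min_le_left _ _).trans (by simp), rfl⟩
    | succ j ih =>
      obtain ⟨s, h1, h2, h3, h4⟩ := ih
      have hs0 : 0 ≤ s := hr.le.trans h1
      obtain ⟨c', hc'⟩ := H.exists_G_const hs0 h2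
      have hmem := constE_mem_tube (k := k) (d := d) hs0 h2
      obtain ⟨x, hx1, hx2, hx3, hx4⟩ := ((H.G_mem hmem).and
        ((ae_abs_sub_le_norm (G (constE k d s)) (G (constE k d r))).and
        ((ev_const (k := k) (d := d) c').and (ev_const (k := k) (d := d) c)))).exists
      rw [hc', hx3] at hx1
      have hcc : |c' - c| ≤ l * (s - r) := by
        rw [hc', hc, hx3, hx4] at hx2
        have h5 := H.G_lip _ hmem _ (constE_mem_tube (k := k) (d := d) hr.le hrθ.le)
        rw [hc', hc] at h5
        refine (hx2.trans h5).trans (mul_le_mul_of_nonneg_left ?_ hl.le)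
        refine norm_sub_le_of_ae (sub_nonneg.2 h1) ?_
        filter_upwards [ev_const (k := k) (d := d) s, ev_const (k := k) (d := d) r] with z e1 e2
        rw [e1, e2, abs_of_nonneg (sub_nonneg.2 h1)]
      have hup : 0 ≤ τ * (s * (κ - m - c')) :=
        mul_nonneg hτ0 (mul_nonneg hs0 (by linarith [hx1.2]))
      refine ⟨s + τ * (s * (κ - m - c')), by linarith, ?_, ?_, ?_⟩
      · have h6 : ∀ᵐ z, 0 ≤ ev (eulerStep (field κ m a G) τ (constE k d s)) z ∧
            ev (eulerStep (field κ m a G) τ (constE k d s)) z ≤ θ := H.eulerStep_mem hτ0 hn.2 hmem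
        rw [H.eulerStep_const τ hc'] at h6
        obtain ⟨z, e1, e2⟩ := (h6.and (ev_const (k := k) (d := d)
          (s + τ * (s * (κ - m - c'))))).exists
        rw [e2] at e1; exact e1.2
      · rcases le_or_gt (r + η / (2 * l)) s with h7 | h7
        · exact (min_le_right _ _).trans (by linarith)
        · refine (min_le_left _ _).trans ?_
          have h8 : r + j * τ * (r * (η / 2)) ≤ s := by
            rcases min_le_iff.1 h3 with h9 | h9
            · exact h9
            · linarith
          have h10 : η / 2 ≤ κ - m - c' := by
            have h11 : l * (s - r) ≤ η / 2 := by
              have : l * (η / (2 * l)) = η / 2 := by field_simp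
              nlinarith
            have := (abs_le.1 hcc).2
            linarith
          have h12 : r * (η / 2) ≤ s * (κ - m - c') := mul_le_mul h1 h10 (by positivity) hs0
          have := mul_le_mul_of_nonneg_left h12 hτ0
          push_cast
          linarith
      · rw [Function.iterate_succ_apply', h4, H.eulerStep_const τ hc']
  obtain ⟨s, h1, h2, h3, h4⟩ := key n
  rw [h4]
  have e : (n : ℝ) * τ = t := by rw [hτ]; field_simp
  rw [e] at h3
  filter_upwards [ev_const (k := k) (d := d) s, ev_const (k := k) (d := d)
    (min (r + t * (r * (η / 2))) (r + η / (2 * l)))] with x e1 e2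
  rw [e1, e2]; exact h3

end Reaction

/-! ### Planar ramps below solutions -/

/-- The planar function `x ↦ q min(R, (b - x · ξ)⁺)` as an element of `E`. -/
noncomputable def rampE (k : SpaceKind) (q R : ℝ) (ξ : X d) (b : ℝ) : E k d :=
  toE k fun x => q * ramp R (b - inner ℝ x ξ)

theorem ev_rampE {q R : ℝ} (hq : 0 ≤ q) (hR : 0 ≤ R) (ξ : X d) (b : ℝ) :
    ev (rampE k q R ξ b) =ᵐ[volume] fun x => q * ramp R (b - inner ℝ x ξ) := by
  refine ev_toE (exists_ev_eq_of_uniformContinuous k (C := q * R) ?_ fun x => ?_)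
  · have h1 : UniformContinuous fun x : X d => b - inner ℝ x ξ := by
      have : (fun x : X d => b - inner ℝ x ξ) = fun x => b - innerSL ℝ ξ x := by
        funext x; rw [innerSL_apply_apply, real_inner_comm]
      rw [this]
      exact uniformContinuous_const.sub (innerSL ℝ ξ).uniformContinuous
    exact ((lipschitzWith_ramp R).uniformContinuous.comp h1).const_smul q
  · rw [abs_of_nonneg (mul_nonneg hq (ramp_nonneg hR _))]
    exact mul_le_mul_of_nonneg_left (ramp_le _ _) hq

theorem rampE_mem_tube {θ q R : ℝ} (hq : 0 ≤ q) (hR : 0 ≤ R) (hqR : q * R ≤ θ) (ξ : X d) (b : ℝ) :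
    rampE k q R ξ b ∈ tube k d θ := by
  filter_upwards [ev_rampE (k := k) hq hR ξ b] with x hx
  rw [hx]
  exact ⟨mul_nonneg hq (ramp_nonneg hR _),
    (mul_le_mul_of_nonneg_left (ramp_le _ _) hq).trans hqR⟩

namespace Reaction

variable {κ m θ l p : ℝ} {a : X d → ℝ} {G : E k d → E k d}

/-- A small travelling ramp of the linearized equation stays below the Euler scheme of the nonlinear
equation: for values in `[0, q R]` the Lipschitz condition gives `G v ≤ l q R`, which costs at most
half of the growth rate `κ - m`. -/
theorem rampE_le_eulerStep (H : Reaction κ m θ l p a G) {δ q R : ℝ} (hq : 0 ≤ q) (hR : 0 ≤ R)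
    (hqR : q * R ≤ θ) (hqRl : l * (q * R) ≤ (κ - m) / 2) {ξ : X d} {τ : ℝ} (hτ : 0 ≤ τ)
    (hramp : ∀ h : ℝ, ramp R (h + τ * (κ * (∫ y, a y * inner ℝ y ξ) + δ)) ≤
        ramp R h + τ * (κ * (∫ y, a y * ramp R (h + inner ℝ y ξ)) -
          (κ - (κ - m) / 2) * ramp R h)) (b : ℝ) :
    LEae (rampE k q R ξ (b + τ * (κ * (∫ y, a y * inner ℝ y ξ) + δ)))
      (eulerStep (field κ m a G) τ (rampE k q R ξ b)) := by
  have hmem := rampE_mem_tube (k := k) hq hR hqR ξ b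
  have z := constE_mem_tube (k := k) (d := d) le_rfl H.θ_pos.le
  have hGn : ‖G (rampE k q R ξ b) - G (constE k d 0)‖ ≤ (κ - m) / 2 := by
    refine (H.G_lip _ hmem _ z).trans ((mul_le_mul_of_nonneg_left ?_ H.l_pos.le).trans hqRl)
    refine norm_sub_le_of_ae (mul_nonneg hq hR) ?_
    filter_upwards [ev_rampE (k := k) hq hR ξ b, ev_const (k := k) (d := d) 0] with x h1 h2
    rw [h1, h2, sub_zero, abs_of_nonneg (mul_nonneg hq (ramp_nonneg hR _))]
    exact mul_le_mul_of_nonneg_left (ramp_le _ _) hq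
  filter_upwards [ev_rampE (k := k) hq hR ξ (b + τ * (κ * (∫ y, a y * inner ℝ y ξ) + δ)),
    ev_rampE (k := k) hq hR ξ b, ev_eulerStep H.a_int κ m G τ (rampE k q R ξ b),
    (ae_abs_sub_le_norm (G (rampE k q R ξ b)) (G (constE k d 0))), ev_const (k := k) (d := d) 0]
    with x h1 h2 h3 h4 h5
  rw [H.G_zero, h5, sub_zero] at h4
  rw [H.G_zero] at hGn
  have hG := (le_abs_self _).trans (h4.trans hGn)
  have hconv : conv a (ev (rampE k q R ξ b)) x =
      q * ∫ y, a y * ramp R (b - inner ℝ x ξ + inner ℝ y ξ) := by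
    have hqm := quasiMeasurePreserving_sub_left (volume : Measure (X d)) x
    rw [conv_eq_swap, ← integral_const_mul]
    refine integral_congr_ae ?_
    filter_upwards [hqm.ae (ev_rampE (k := k) hq hR ξ b)] with y hy
    rw [hy, inner_sub_left]
    have e : b - (inner ℝ x ξ - inner ℝ y ξ) = b - inner ℝ x ξ + inner ℝ y ξ := by ring
    rw [e]; ring
  rw [h1, h3, hconv, h2]
  have h6 := mul_le_mul_of_nonneg_left (hramp (b - inner ℝ x ξ)) hq
  have e : b + τ * (κ * (∫ y, a y * inner ℝ y ξ) + δ) - inner ℝ x ξ =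
      b - inner ℝ x ξ + τ * (κ * (∫ y, a y * inner ℝ y ξ) + δ) := by ring
  rw [e]
  have h7 := mul_le_mul_of_nonneg_left hG
    (mul_nonneg hτ (mul_nonneg hq (ramp_nonneg hR (b - inner ℝ x ξ))))
  linarith

theorem rampE_le_solMap (H : Reaction κ m θ l p a G) {δ q R : ℝ} (hq : 0 ≤ q) (hR : 0 ≤ R)
    (hqR : q * R ≤ θ) (hqRl : l * (q * R) ≤ (κ - m) / 2) {ξ : X d}
    (hramp : ∀ τ, 0 ≤ τ → τ * κ ≤ 1 → ∀ h : ℝ,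
      ramp R (h + τ * (κ * (∫ y, a y * inner ℝ y ξ) + δ)) ≤
        ramp R h + τ * (κ * (∫ y, a y * ramp R (h + inner ℝ y ξ)) -
          (κ - (κ - m) / 2) * ramp R h)) {t : ℝ} (ht : 0 ≤ t) (b : ℝ) :
    LEae (rampE k q R ξ (b + t * (κ * (∫ y, a y * inner ℝ y ξ) + δ)))
      (solMap κ m θ a G t (rampE k q R ξ b)) := by
  have hmem := fun b => rampE_mem_tube (k := k) hq hR hqR ξ b
  refine LEae.of_tendsto tendsto_const_nhds (H.tendsto_iterate_solMap ht (hmem b)) ?_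
  filter_upwards [eventually_small_step t (m + p), eventually_small_step t κ] with n hn hn'
  have hn0 : (0 : ℝ) < n := Nat.cast_pos.2 hn.1
  set τ := t / n with hτd
  have hτ : 0 ≤ τ := by positivity
  set c := κ * (∫ y, a y * inner ℝ y ξ) + δ with hc
  have hS : ∀ z ∈ tube k d θ, eulerStep (field κ m a G) τ z ∈ tube k d θ :=
    fun z hz => H.eulerStep_mem hτ hn.2 hz
  have key : ∀ j : ℕ, LEae (rampE k q R ξ (b + j * τ * c))
      ((eulerStep (field κ m a G) τ)^[j] (rampE k q R ξ b)) := by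
    intro j
    induction j with
    | zero =>
      have e : b + ((0 : ℕ) : ℝ) * τ * c = b := by simp
      rw [e]; exact Eventually.of_forall fun _ => le_rfl
    | succ j ih =>
      rw [Function.iterate_succ_apply']
      have h1 := H.rampE_le_eulerStep hq hR hqR hqRl hτ (hramp τ hτ hn'.2) (b + j * τ * c)
      have h2 := H.eulerStep_mono hτ hn.2 (hmem _) (iterate_mem_of_mapsTo hS (hmem b) j) ih
      have e : b + ((j + 1 : ℕ) : ℝ) * τ * c = b + j * τ * c + τ * c := by push_cast; ring
      rw [e]
      exact h1.trans h2
  have e : (n : ℝ) * τ = t := by rw [hτd]; field_simp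
  have := key n
  rwa [e] at this

end Reaction

/-- High ramps converge locally uniformly to a constant as the front recedes. -/
theorem locUnif_rampE {r : ℝ} (hr : 0 ≤ r) {ξ : X d} (hξ : ‖ξ‖ = 1) :
    LocUnif (fun n : ℕ => rampE k 1 r ξ n) (constE k d r) := by
  intro K hK ε hε
  obtain ⟨M, hM⟩ := hK.isBounded.exists_norm_le
  filter_upwards [eventually_ge_atTop ⌈r + M⌉₊] with n hn
  have hn' : r + M ≤ n := (Nat.le_ceil _).trans (Nat.cast_le.2 hn)
  filter_upwards [ev_rampE (k := k) zero_le_one hr ξ n, ev_const (k := k) (d := d) r]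
    with x h1 h2 hx
  have h3 := (abs_le.1 (abs_inner_le_norm_of_unit hξ x)).2
  rw [h1, h2, ramp_of_le hr (by linarith [hM x hx]), one_mul, sub_self, abs_zero]
  exact hε.le

/-! ### The wave iteration -/

/-- The uniformly continuous non-increasing functions on `ℝ` with values in `[0, θ]`. -/
structure IsFront (θ : ℝ) (g : ℝ → ℝ) : Prop where
  uc : UniformContinuous g
  anti : Antitone g
  mem : ∀ s, g s ∈ Icc 0 θ

theorem isFront_of_mem_profiles {θ : ℝ} {φ : ℝ → ℝ} (hφ : φ ∈ profiles θ) : IsFront θ φ := by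
  obtain ⟨hc, ha, h0, L, hL, hlim⟩ := hφ
  refine ⟨?_, ha, fun s => ⟨?_, ?_⟩⟩
  · -- subtracting a ramp from `φ` leaves a continuous function that vanishes at infinity
    set ψ : ℝ → ℝ := fun s => L * ramp 1 (-s) with hψ
    have hψu : UniformContinuous ψ :=
      ((lipschitzWith_ramp 1).uniformContinuous.comp uniformContinuous_neg).const_smul L
    have h2 : UniformContinuous fun s => φ s - ψ s := by
      refine (hc.sub hψu.continuous).uniformContinuous_of_tendsto_cocompact (x := 0) ?_
      rw [cocompact_eq_atBot_atTop, tendsto_sup]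
      constructor
      · have h3 : Tendsto ψ atBot (𝓝 L) := by
          refine tendsto_const_nhds.congr' ?_
          filter_upwards [eventually_le_atBot (-1 : ℝ)] with s hs
          rw [hψ]; simp only
          rw [ramp_of_le zero_le_one (by linarith), mul_one]
        simpa using hlim.sub h3
      · refine tendsto_const_nhds.congr' ?_
        filter_upwards [eventually_ge_atTop (0 : ℝ)] with s hs
        rw [hψ]; simp only
        rw [h0 s hs, ramp_of_nonpos zero_le_one (by linarith), mul_zero, sub_zero]
    simpa using h2.add hψu
  · rw [← h0 (max s 0) (le_max_right _ _)]; exact ha (le_max_left _ _)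
  · exact (ha.ge_of_tendsto hlim s).trans hL.2.le

theorem IsFront.uniformContinuous_planar {θ : ℝ} {g : ℝ → ℝ} (hg : IsFront θ g) (s c : ℝ)
    (ξ : X d) : UniformContinuous fun x : X d => g (inner ℝ x ξ + s + c) := by
  have : (fun x : X d => inner ℝ x ξ + s + c) = fun x => innerSL ℝ ξ x + s + c := by
    funext x; rw [innerSL_apply_apply, real_inner_comm]
  have h1 : UniformContinuous fun x : X d => inner ℝ x ξ + s + c := by
    rw [this]
    exact ((innerSL ℝ ξ).uniformContinuous.add uniformContinuous_const).add
      uniformContinuous_const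
  exact hg.uc.comp h1

theorem IsFront.ev_planeWave {θ : ℝ} {g : ℝ → ℝ} (hg : IsFront θ g) (s c : ℝ) (ξ : X d) :
    ev (planeWave k s c ξ g) =ᵐ[volume] fun x => g (inner ℝ x ξ + s + c) :=
  ev_toE (exists_ev_eq_of_uniformContinuous k (C := θ) (hg.uniformContinuous_planar s c ξ)
    fun x => by rw [abs_of_nonneg (hg.mem _).1]; exact (hg.mem _).2)

theorem IsFront.planeWave_mem {θ : ℝ} {g : ℝ → ℝ} (hg : IsFront θ g) (s c : ℝ) (ξ : X d) :
    planeWave k s c ξ g ∈ tube k d θ := by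
  filter_upwards [hg.ev_planeWave (k := k) s c ξ] with x hx
  rw [hx]; exact hg.mem _

namespace Reaction

variable {κ m θ l p : ℝ} {a : X d → ℝ} {G : E k d → E k d}

theorem hasContRep_planeWave (H : Reaction κ m θ l p a G) {t : ℝ} (ht : 0 ≤ t) {g : ℝ → ℝ}
    (hg : IsFront θ g) (s c : ℝ) (ξ : X d) :
    HasContRep (solMap κ m θ a G t (planeWave k s c ξ g)) :=
  H.hasContRep_solMap ht (hg.planeWave_mem s c ξ) (hg.uniformContinuous_planar s c ξ)
    (hg.ev_planeWave s c ξ)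

theorem waveOp_isFront (H : Reaction κ m θ l p a G) {t : ℝ} (ht : 0 ≤ t) {φ g : ℝ → ℝ}
    (hφ : IsFront θ φ) (hg : IsFront θ g) (c : ℝ) (ξ : X d) :
    IsFront θ (waveOp (solMap κ m θ a G t) φ c ξ g) := by
  have hrep := fun s => H.hasContRep_planeWave ht hg s c ξ
  have hmem := fun s => hg.planeWave_mem (k := k) s c ξ
  refine ⟨?_, fun s s' hs => max_le_max (hφ.anti hs) ?_, fun s => ?_⟩
  · have hC := Real.exp_pos (lip κ m θ l * t)
    have hφu := hφ.uc
    have hgu := hg.uc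
    rw [Metric.uniformContinuous_iff] at hφu hgu ⊢
    intro ε hε
    obtain ⟨δ₁, hδ₁, h1⟩ := hφu ε hε
    obtain ⟨δ₂, hδ₂, h2⟩ := hgu (ε / (2 * Real.exp (lip κ m θ l * t))) (by positivity)
    refine ⟨min δ₁ δ₂, lt_min hδ₁ hδ₂, fun {s s'} hss => ?_⟩
    rw [Real.dist_eq]
    refine (abs_max_sub_max_le_max _ _ _ _).trans_lt (max_lt ?_ ?_)
    · rw [← Real.dist_eq]; exact h1 (hss.trans_le (min_le_left _ _))
    · refine (abs_valueAt_sub_le (hrep s) (hrep s') 0).trans_lt ?_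
      refine (H.norm_solMap_sub_le (hmem s) (hmem s') ht).trans_lt ?_
      have h3 : ‖planeWave k s c ξ g - planeWave k s' c ξ g‖ ≤
          ε / (2 * Real.exp (lip κ m θ l * t)) := by
        refine norm_sub_le_of_ae (by positivity) ?_
        filter_upwards [hg.ev_planeWave (k := k) s c ξ, hg.ev_planeWave (k := k) s' c ξ]
          with x e1 e2
        rw [e1, e2, ← Real.dist_eq]
        refine (h2 ?_).le
        have e : dist (inner ℝ x ξ + s + c) (inner ℝ x ξ + s' + c) = dist s s' := by
          rw [dist_add_right, dist_add_left]
        rw [e]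
        exact hss.trans_le (min_le_right _ _)
      calc _ ≤ _ := mul_le_mul_of_nonneg_left h3 hC.le
        _ = ε / 2 := by field_simp
        _ < ε := half_lt_self hε
  · refine valueAt_mono (hrep s') (hrep s) (H.solMap_mono ht (hmem s') (hmem s) ?_) 0
    filter_upwards [hg.ev_planeWave (k := k) s c ξ, hg.ev_planeWave (k := k) s' c ξ] with x e1 e2
    rw [e1, e2]
    exact hg.anti (by linarith)
  · have h1 := valueAt_mem_Icc (hrep s) (H.solMap_mem (hmem s) ht) 0
    exact ⟨h1.1.trans (le_max_right _ _), max_le (hφ.mem s).2 h1.2⟩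

theorem waveOp_mono (H : Reaction κ m θ l p a G) {t : ℝ} (ht : 0 ≤ t) {φ g g' : ℝ → ℝ}
    (hg : IsFront θ g) (hg' : IsFront θ g') (hgg : ∀ s, g s ≤ g' s) (c : ℝ) (ξ : X d) (s : ℝ) :
    waveOp (solMap κ m θ a G t) φ c ξ g s ≤ waveOp (solMap κ m θ a G t) φ c ξ g' s := by
  refine max_le_max le_rfl (valueAt_mono (H.hasContRep_planeWave ht hg s c ξ)
    (H.hasContRep_planeWave ht hg' s c ξ) (H.solMap_mono ht (hg.planeWave_mem s c ξ)
      (hg'.planeWave_mem s c ξ) ?_) 0)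
  filter_upwards [hg.ev_planeWave (k := k) s c ξ, hg'.ev_planeWave (k := k) s c ξ] with x e1 e2
  rw [e1, e2]
  exact hgg _

theorem waveIter_isFront (H : Reaction κ m θ l p a G) {t : ℝ} (ht : 0 ≤ t) {φ : ℝ → ℝ}
    (hφ : IsFront θ φ) (c : ℝ) (ξ : X d) (n : ℕ) :
    IsFront θ (waveIter (solMap κ m θ a G t) φ c ξ n) := by
  induction n with
  | zero => exact hφ
  | succ n ih => exact H.waveOp_isFront ht hφ ih c ξ

theorem monotone_waveIter (H : Reaction κ m θ l p a G) {t : ℝ} (ht : 0 ≤ t) {φ : ℝ → ℝ}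
    (hφ : IsFront θ φ) (c : ℝ) (ξ : X d) (s : ℝ) :
    Monotone fun n => waveIter (solMap κ m θ a G t) φ c ξ n s := by
  have hfr := H.waveIter_isFront ht hφ c ξ
  have key : ∀ n : ℕ, ∀ s, waveIter (solMap κ m θ a G t) φ c ξ n s ≤
      waveIter (solMap κ m θ a G t) φ c ξ (n + 1) s := by
    intro n
    induction n with
    | zero => exact fun s => le_max_left _ _
    | succ n ih => exact fun s => H.waveOp_mono ht (hfr n) (hfr (n + 1)) ih c ξ s
  exact monotone_nat_of_le_succ fun n => key n s

theorem tendsto_waveIter (H : Reaction κ m θ l p a G) {t : ℝ} (ht : 0 ≤ t) {φ : ℝ → ℝ}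
    (hφ : IsFront θ φ) (c : ℝ) (ξ : X d) (s : ℝ) :
    Tendsto (fun n => waveIter (solMap κ m θ a G t) φ c ξ n s) atTop
      (𝓝 (waveLim (solMap κ m θ a G t) φ c ξ s)) := by
  have hbdd : BddAbove (range fun n => waveIter (solMap κ m θ a G t) φ c ξ n s) :=
    ⟨θ, by rintro _ ⟨n, rfl⟩; exact ((H.waveIter_isFront ht hφ c ξ n).mem s).2⟩
  exact tendsto_nhds_limUnder
    ⟨_, tendsto_atTop_ciSup (H.monotone_waveIter ht hφ c ξ s) hbdd⟩

theorem waveIter_le_waveLim (H : Reaction κ m θ l p a G) {t : ℝ} (ht : 0 ≤ t) {φ : ℝ → ℝ}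
    (hφ : IsFront θ φ) (c : ℝ) (ξ : X d) (n : ℕ) (s : ℝ) :
    waveIter (solMap κ m θ a G t) φ c ξ n s ≤ waveLim (solMap κ m θ a G t) φ c ξ s :=
  (H.monotone_waveIter ht hφ c ξ s).ge_of_tendsto (H.tendsto_waveIter ht hφ c ξ s) n

/-- If the speed `c` of the frame is below that of the travelling ramp, the ramp advances by `e > 0`
in each step of the wave iteration. -/
theorem ramp_le_waveIter (H : Reaction κ m θ l p a G) {t : ℝ} (ht : 0 ≤ t) {φ : ℝ → ℝ}
    (hφ : IsFront θ φ) {c w q R e b : ℝ} {ξ : X d} (hq : 0 ≤ q) (hR : 0 ≤ R) (hqR : q * R ≤ θ)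
    (hw : ∀ b, LEae (rampE k q R ξ (b + w)) (solMap κ m θ a G t (rampE k q R ξ b)))
    (hc : c + e = w) (h0 : ∀ s, q * ramp R (b - s) ≤ φ s) (n : ℕ) (s : ℝ) :
    q * ramp R (b + n * e - s) ≤ waveIter (solMap κ m θ a G t) φ c ξ n s := by
  induction n generalizing s with
  | zero =>
    have e1 : b + ((0 : ℕ) : ℝ) * e - s = b - s := by simp
    rw [e1]; exact h0 s
  | succ n ih =>
    have hf := H.waveIter_isFront ht hφ c ξ n
    refine le_max_of_le_right ?_
    have h1 : LEae (rampE k q R ξ (b + n * e - s - c))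
        (planeWave k s c ξ (waveIter (solMap κ m θ a G t) φ c ξ n)) := by
      filter_upwards [ev_rampE (k := k) hq hR ξ (b + n * e - s - c), hf.ev_planeWave (k := k) s c ξ]
        with x e1 e2
      rw [e1, e2]
      refine le_trans (le_of_eq ?_) (ih _)
      congr 2; ring
    have h2 := (hw _).trans
      (H.solMap_mono ht (rampE_mem_tube hq hR hqR ξ _) (hf.planeWave_mem s c ξ) h1)
    have h3 := le_valueAt (H.hasContRep_planeWave ht hf s c ξ) isOpen_univ (mem_univ (0 : X d))
      (h := fun x => q * ramp R (b + n * e - s - c + w - inner ℝ x ξ))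
      (continuous_const.mul ((continuous_ramp R).comp (by fun_prop))) (by
        filter_upwards [h2, ev_rampE (k := k) hq hR ξ (b + n * e - s - c + w)] with x e1 e2 _
        rw [← e2]; exact e1)
    refine le_trans (le_of_eq ?_) h3
    simp only [inner_zero_left]
    rw [← hc]
    push_cast
    congr 2; ring

/-- A positive lower bound below `θ` for the limit of the wave iteration can be improved, since the
solution map strictly increases the constants in `(0, θ)` and is continuous for the locally
uniform convergence. -/
theorem exists_gt_le_waveLim (H : Reaction κ m θ l p a G) {t : ℝ} (ht : 0 < t) {φ : ℝ → ℝ}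
    (hφ : IsFront θ φ) (c : ℝ) {ξ : X d} (hξ : ‖ξ‖ = 1) {r : ℝ} (hr : 0 < r) (hrθ : r < θ)
    (h : ∀ s, r ≤ waveLim (solMap κ m θ a G t) φ c ξ s) :
    ∃ r' > r, ∀ s, r' ≤ waveLim (solMap κ m θ a G t) φ c ξ s := by
  obtain ⟨ρ, hρ, hQρ⟩ := H.exists_const_lt_solMap_const ht hr hrθ
  set C := Real.exp (lip κ m θ l * t) with hC
  have hCpos : 0 < C := Real.exp_pos _
  set η := min (r / 2) ((ρ - r) / (4 * C)) with hη
  have hηpos : 0 < η := lt_min (by positivity) (div_pos (by linarith) (by positivity))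
  have hηr : η ≤ r / 2 := min_le_left _ _
  have hηC : C * η ≤ (ρ - r) / 4 := by
    have h1 := mul_le_mul_of_nonneg_left (min_le_right (r / 2) ((ρ - r) / (4 * C))) hCpos.le
    rw [← hη] at h1
    refine h1.trans (le_of_eq ?_)
    field_simp
  have hr1 : 0 ≤ r - η := by linarith
  have hm1 := constE_mem_tube (k := k) (d := d) (θ := θ) hr1 (by linarith)
  have hm := constE_mem_tube (k := k) (d := d) (θ := θ) hr.le hrθ.le
  have hwm : ∀ n : ℕ, rampE k 1 (r - η) ξ n ∈ tube k d θ := fun n =>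
    rampE_mem_tube zero_le_one hr1 (by linarith) ξ n
  have hlip := H.norm_solMap_sub_le hm hm1 ht.le
  have hcc : ‖constE k d r - constE k d (r - η)‖ ≤ η := by
    refine norm_sub_le_of_ae hηpos.le ?_
    filter_upwards [ev_const (k := k) (d := d) r, ev_const (k := k) (d := d) (r - η)] with x e1 e2
    rw [e1, e2, sub_sub_cancel, abs_of_pos hηpos]
  have hlip' := (hlip.trans (mul_le_mul_of_nonneg_left hcc hCpos.le)).trans hηC
  obtain ⟨N, hN⟩ := (H.solMap_locUnif ht.le hwm hm1 (locUnif_rampE hr1 hξ)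
    (Metric.closedBall 0 1) (isCompact_closedBall _ _) ((ρ - r) / 4) (by linarith)).exists
  refine ⟨(ρ + r) / 2, by linarith, fun s => ?_⟩
  have hev : ∀ᶠ j in atTop, r - η < waveIter (solMap κ m θ a G t) φ c ξ j (N + s + c) :=
    (H.tendsto_waveIter ht.le hφ c ξ (N + s + c)).eventually
      (lt_mem_nhds (by linarith [h (N + s + c)]))
  obtain ⟨j, hj⟩ := hev.exists
  refine le_trans ?_ (H.waveIter_le_waveLim ht.le hφ c ξ (j + 1) s)
  have hf := H.waveIter_isFront ht.le hφ c ξ j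
  refine le_max_of_le_right ?_
  have h1 : LEae (rampE k 1 (r - η) ξ N)
      (planeWave k s c ξ (waveIter (solMap κ m θ a G t) φ c ξ j)) := by
    filter_upwards [ev_rampE (k := k) zero_le_one hr1 ξ N, hf.ev_planeWave (k := k) s c ξ]
      with x e1 e2
    rw [e1, e2, one_mul]
    rcases le_or_gt (inner ℝ x ξ) (N : ℝ) with hx | hx
    · exact (ramp_le _ _).trans (hj.le.trans (hf.anti (by linarith)))
    · rw [ramp_of_nonpos hr1 (by linarith)]; exact (hf.mem _).1
  have h2 := H.solMap_mono ht.le (hwm N) (hf.planeWave_mem s c ξ) h1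
  refine le_valueAt (H.hasContRep_planeWave ht.le hf s c ξ) (U := Metric.ball 0 1)
    Metric.isOpen_ball (Metric.mem_ball_self one_pos) (h := fun _ => (ρ + r) / 2)
    continuous_const ?_
  filter_upwards [h2, hN, hQρ, ev_const (k := k) (d := d) ρ,
    ae_abs_sub_le_norm (solMap κ m θ a G t (constE k d r))
      (solMap κ m θ a G t (constE k d (r - η)))] with x e1 e2 e3 e4 e5 hx
  have e2 := (abs_le.1 (e2 (Metric.ball_subset_closedBall hx))).1
  have e5 := (abs_le.1 (e5.trans hlip')).2
  rw [e4] at e3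
  linarith

theorem waveLim_eq_top (H : Reaction κ m θ l p a G) {t : ℝ} (ht : 0 < t) {φ : ℝ → ℝ}
    (hφ : IsFront θ φ) (c : ℝ) {ξ : X d} (hξ : ‖ξ‖ = 1) {r : ℝ} (hr : 0 < r)
    (h : ∀ s, r ≤ waveLim (solMap κ m θ a G t) φ c ξ s) (s : ℝ) :
    waveLim (solMap κ m θ a G t) φ c ξ s = θ := by
  have hle : ∀ s, waveLim (solMap κ m θ a G t) φ c ξ s ≤ θ := fun s =>
    le_of_tendsto' (H.tendsto_waveIter ht.le hφ c ξ s) fun n =>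
      ((H.waveIter_isFront ht.le hφ c ξ n).mem s).2
  have hbdd : BddBelow (range (waveLim (solMap κ m θ a G t) φ c ξ)) :=
    ⟨r, by rintro _ ⟨s, rfl⟩; exact h s⟩
  refine le_antisymm (hle s) (le_trans ?_ (ciInf_le hbdd s))
  by_contra! hlt
  obtain ⟨r', h1, h2⟩ := H.exists_gt_le_waveLim ht hφ c hξ
    (hr.trans_le (le_ciInf h)) hlt (fun s => ciInf_le hbdd s)
  exact absurd (le_ciInf h2) (not_le.2 h1)

theorem inner_firstMoment (H : Reaction κ m θ l p a G) (ξ : X d) :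
    inner ℝ (firstMoment κ a) ξ = κ * ∫ y, a y * inner ℝ y ξ := by
  have hi : Integrable fun y : X d => a y • y := by
    refine H.a_moment.mono' (H.a_int.aestronglyMeasurable.smul
      continuous_id.aestronglyMeasurable) ?_
    filter_upwards [H.a_nonneg] with y hy
    rw [norm_smul, Real.norm_of_nonneg hy, mul_comm]
  rw [firstMoment, inner_smul_left, real_inner_comm, ← integral_inner hi]
  simp only [inner_smul_right, conj_trivial]
  congr 1
  exact integral_congr_ae (Eventually.of_forall fun y => by simp only [real_inner_comm])

/-- The spreading speed in each direction exceeds the drift by an amount that does not depend on the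
direction. -/
theorem exists_lt_spreadingSpeed (H : Reaction κ m θ l p a G) {ρ : ℝ} (hρ : 0 < ρ)
    (haρ : ∀ᵐ x, x ∈ Metric.ball (0 : X d) ρ → ρ ≤ a x) {φ : ℝ → ℝ} (hφ : φ ∈ profiles θ)
    {t : ℝ} (ht : 0 < t) :
    ∃ δ > 0, ∀ ξ : X d, ‖ξ‖ = 1 →
      ((inner ℝ (t • firstMoment κ a) ξ + δ : ℝ) : EReal) ≤
        spreadingSpeed (solMap κ m θ a G t) φ θ ξ := by
  have hβ := H.β_pos
  have hl := H.l_pos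
  have hθ := H.θ_pos
  obtain ⟨δ, hδ, R, hR, hramp⟩ := exists_travelling_ramp H.κ_pos (half_pos hβ) H.a_int
    H.a_nonneg H.a_one H.a_moment hρ haρ
  refine ⟨t * (δ / 2), by positivity, fun ξ hξ => ?_⟩
  have hfr := isFront_of_mem_profiles hφ
  obtain ⟨-, hanti, -, L, hL, hlim⟩ := hφ
  obtain ⟨b, hb⟩ := (hlim.eventually (lt_mem_nhds (half_lt_self hL.1))).exists
  -- the amplitude of the ramp: below `θ`, below the profile, and small for the linearization
  set A := min (L / 2) ((κ - m) / (2 * l)) with hA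
  have hApos : 0 < A := lt_min (half_pos hL.1) (by positivity)
  have hAL : A ≤ L / 2 := min_le_left _ _
  have hAl : l * A ≤ (κ - m) / 2 := by
    have h1 := mul_le_mul_of_nonneg_left (min_le_right (L / 2) ((κ - m) / (2 * l))) hl.le
    rw [← hA] at h1
    refine h1.trans (le_of_eq ?_)
    field_simp
  set q := A / R with hq
  have hq0 : 0 ≤ q := by positivity
  have hqR : q * R = A := by rw [hq]; field_simp
  set w := t * (κ * (∫ y, a y * inner ℝ y ξ) + δ) with hw
  set c := inner ℝ (t • firstMoment κ a) ξ + t * (δ / 2) with hc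
  have hcw : c + t * (δ / 2) = w := by
    rw [hc, hw, inner_smul_left, H.inner_firstMoment]
    simp only [conj_trivial]
    ring
  have hsub := fun b => H.rampE_le_solMap hq0 hR.le (by rw [hqR]; linarith [hL.2])
    (by rw [hqR]; exact hAl) (hramp ξ hξ) ht.le b
  have hinit : ∀ s, q * ramp R (b - s) ≤ φ s := fun s => by
    rcases le_or_gt s b with hs | hs
    · refine (mul_le_mul_of_nonneg_left (ramp_le R _) hq0).trans ?_
      rw [hqR]
      linarith [hanti hs]
    · rw [ramp_of_nonpos hR.le (by linarith), mul_zero]; exact (hfr.mem s).1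
  have hlow : ∀ s, A ≤ waveLim (solMap κ m θ a G t) φ c ξ s := fun s => by
    obtain ⟨n, hn⟩ := exists_nat_gt ((R + s - b) / (t * (δ / 2)))
    rw [div_lt_iff₀ (by positivity)] at hn
    have h1 := H.ramp_le_waveIter ht.le hfr hq0 hR.le (by rw [hqR]; linarith [hL.2]) hsub hcw
      hinit n s
    rw [ramp_of_le hR.le (by linarith), hqR] at h1
    exact h1.trans (H.waveIter_le_waveLim ht.le hfr c ξ n s)
  refine le_sSup ⟨c, ?_, rfl⟩
  have heq : waveLim (solMap κ m θ a G t) φ c ξ = fun _ => θ :=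
    funext (H.waveLim_eq_top ht hfr c hξ hApos hlow)
  change Tendsto (waveLim (solMap κ m θ a G t) φ c ξ) atTop (𝓝 θ)
  rw [heq]
  exact tendsto_const_nhds

theorem drift_mem_interior_spreadingSet (H : Reaction κ m θ l p a G) {ρ : ℝ} (hρ : 0 < ρ)
    (haρ : ∀ᵐ x, x ∈ Metric.ball (0 : X d) ρ → ρ ≤ a x) {φ : ℝ → ℝ} (hφ : φ ∈ profiles θ)
    {t : ℝ} (ht : 0 < t) :
    t • firstMoment κ a ∈ interior (spreadingSet (solMap κ m θ a G t) φ θ) := by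
  obtain ⟨δ, hδ, h⟩ := H.exists_lt_spreadingSpeed hρ haρ hφ ht
  rw [mem_interior_iff_mem_nhds, Metric.mem_nhds_iff]
  refine ⟨δ, hδ, fun x hx ξ hξ => le_trans ?_ (h ξ hξ)⟩
  rw [EReal.coe_le_coe_iff]
  have h1 := (abs_le.1 (abs_inner_le_norm_of_unit hξ (x - t • firstMoment κ a))).2
  rw [inner_sub_left] at h1
  rw [mem_ball_iff_norm] at hx
  linarith

end Reaction
end HairTrigger

open HairTrigger
theorem proposition5p10
    (d : ℕ) (hd : 1 ≤ d) (k : SpaceKind)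
    (κ m θ : ℝ) (hκ : 0 < κ) (hm : 0 < m) (hθ : 0 < θ)
    (a : X d → ℝ) (ha_int : Integrable a) (ha_nonneg : ∀ᵐ x, 0 ≤ a x)
    (ha_one : ∫ x, a x = 1)
    (G : E k d → E k d)
    (hA1 : 0 < κ - m)
    (hA2 : G (constE k d 0) = constE k d 0 ∧ G (constE k d θ) = constE k d (κ - m) ∧
      ∀ v ∈ tube k d θ, LEae (constE k d 0) (G v) ∧
        LEae (G v) (constE k d (κ - m)))
    (hA3 : ∃ l : ℝ, 0 < l ∧ ∀ v ∈ tube k d θ, ∀ w ∈ tube k d θ, ‖G v - G w‖ ≤ l * ‖v - w‖)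
    (hA4 : ∃ p : ℝ, 0 ≤ p ∧ ∀ v ∈ tube k d θ, ∀ w ∈ tube k d θ, LEae v w →
      ∀ᵐ x, κ * conv a (ev v) x - ev v x * ev (G v) x + p * ev v x
        ≤ κ * conv a (ev w) x - ev w x * ev (G w) x + p * ev w x)
    (hA5 : ∃ ρ : ℝ, 0 < ρ ∧ ∀ᵐ x, x ∈ Metric.ball (0 : X d) ρ → ρ ≤ a x)
    (hA6 : ∀ (v : ℕ → E k d) (w : E k d), (∀ n, v n ∈ tube k d θ) → w ∈ tube k d θ →
      LocUnif v w → LocUnif (fun n => G (v n)) (G w))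
    (hA7 : ∀ v ∈ tube k d θ, ∀ y : X d, translate y (G v) = G (translate y v))
    (hA8 : ∀ r : ℝ, 0 < r → r < θ → ∀ᵐ x, ev (G (constE k d r)) x < κ - m)
    (hA9 : Integrable fun y : X d => ‖y‖ * a y)
    (φ : ℝ → ℝ) (hφ : φ ∈ profiles θ) :
    (∀ t : ℝ, 0 < t →
      t • firstMoment κ a ∈ interior (spreadingSet (solMap κ m θ a G t) φ θ)) ∧
    ((∃ K : Set (X d), IsCompact K ∧
        K ⊆ interior (spreadingSet (solMap κ m θ a G 1) φ θ) ∧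
        firstMoment κ a ∈ interior K) ∧
      ∀ j : ℕ, 1 ≤ j → (1 / (j : ℝ)) • firstMoment κ a ∈
        interior (spreadingSet (solMap κ m θ a G (1 / (j : ℝ))) φ θ)) := by
  obtain ⟨l, hl, hlip⟩ := hA3
  obtain ⟨p, hp, hmono⟩ := hA4
  obtain ⟨ρ, hρ, haρ⟩ := hA5
  have H : Reaction κ m θ l p a G :=
    { κ_pos := hκ, m_pos := hm, θ_pos := hθ, a_int := ha_int, a_nonneg := ha_nonneg,
      a_one := ha_one, a_moment := hA9, β_pos := hA1, G_zero := hA2.1, G_top := hA2.2.1,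
      G_nonneg := fun v hv => (hA2.2.2 v hv).1, G_le := fun v hv => (hA2.2.2 v hv).2,
      l_pos := hl, G_lip := hlip, p_nonneg := hp, mono := hmono, G_cont := hA6,
      G_translate := hA7, G_const_lt := hA8 }
  have main : ∀ t : ℝ, 0 < t →
      t • firstMoment κ a ∈ interior (spreadingSet (solMap κ m θ a G t) φ θ) := fun t ht =>
    H.drift_mem_interior_spreadingSet hρ haρ hφ ht
  refine ⟨main, ?_, fun j hj => main _ (by positivity)⟩
  have h1 := main 1 one_pos
  rw [one_smul] at h1
  obtain ⟨K, hK, hmem, hsub⟩ := exists_compact_subset isOpen_interior h1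
  exact ⟨K, hK, hsub, hmem⟩
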